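/- Let $d\in\{2,3\}$ and $k_d=\binom d2$. Let $\Omega\subset\mathbb R^d$ be the interior of the union of the closed simplices of a finite conforming simplicial mesh $\Omega_h$ (this covers every bounded Lipschitz domain tessellated by $\Omega_h$), and let $\Gamma\subseteq\partial\Omega$ be the part of the boundary carrying essential boundary conditions. Assume that the mesh is shape regular with parameter $\gamma$: every element $\Delta$ contains a ball of some radius $\rho>0$ with $\operatorname{diam}\Delta\le\gamma\rho$. Let $\ell\ge 0$ be continuous on $\Omega$ and have a weak gradient, with $\|\ell\|_{L^\infty(\Omega)}+\|\nabla\ell\|_{L^\infty(\Omega)}\le L$. Let $\mathrm{BDM}_1$ be the space of vector fields in $H_{\mathrm{div}}(\Omega)$ that are affine on each element, $P_1$ the space of (discontinuous) functions that are affine on each element, and $R_h=L_1^{k_d}$, where $L_1\subset P_1$ is the space of continuous, elementwise affine functions. The divergence of a $k$-tuple of vector fields is taken in each of the $k$ vector fields. Put $$\Sigma_h=\{\sigma\in \mathrm{BDM}_1^{d}:\ n\cdot\sigma=0\text{ on }\Gamma\},\qquad W_h=\{\omega\in \mathrm{BDM}_1^{k_d}:\ \nabla\cdot(\ell\omega)\in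 L^2(\Omega)^{k_d},\ n\cdot\ell\omega=0\text{ on }\Gamma\},\qquad X_h=\Sigma_h\times W_h,$$ with normal traces and divergences understood weakly. Let $\Pi_R$ and $\Pi_1$ be the $L^2(\Omega)$-orthogonal projections of $L^2(\Omega)^{k_d}$ onto $R_h$ and onto $P_1^{k_d}$. For $\phi,\psi\in P_1^{k_d}$ let $$(\phi,\psi)_{Q_1}=\sum_{\Delta\in\Omega_h}\frac{|\Delta|}{d+1}\sum_{x\in\mathcal N(\Delta)}\phi|_\Delta(x)\cdot\psi|_\Delta(x),$$ where $\mathcal N(\Delta)$ is the set of the $d+1$ vertices of $\Delta$, and for $r\in L^2(\Omega)^{k_d}$ let $\Pi_R^Q r\in R_h$ be defined by $(\Pi_R^Q r,r')_{Q_1}=(\Pi_1 r,r')_{Q_1}$ for all $r'\in R_h$. For $\eta=(\sigma,\omega)\in X_h$ define $$\|\eta\|_{X_h}^2=\|\sigma\|_\Omega^2+\|\nabla\cdot\sigma\|_\Omega^2+\|\omega\|_\Omega^2+\|\Pi_R\nabla\cdot(\ell\omega)\|_\Omega^2,$$ $$\|\eta\|_{X_Q}^2=\|\sigma\|_\Omega^2+\|\nabla\cdot\sigma\|_\Omega^2+\|\omega\|_\Omega^2+\|\Pi_R^Q\nabla\cdot(\ell\omega)\|_\Omega^2,$$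 where $\|\cdot\|_\Omega$ is the $L^2(\Omega)$-norm. If $\ell|_\Delta\in W^{2,\infty}(\Delta)$ for each element $\Delta\in\Omega_h$, then the two norms are equivalent: there is a constant $C>0$ that depends only on $d$, $\gamma$ and $L$ (so not on the mesh or its mesh size, nor on $\Omega$, $\Gamma$ or $\ell$ otherwise) such that $$\|\eta_h\|_{X_Q}\le C\,\|\eta_h\|_{X_h}\quad\text{and}\quad \|\eta_h\|_{X_h}\le C\,\|\eta_h\|_{X_Q}\qquad\text{for all }\eta_h\in X_h.$$ -/

import Mathlib

open MeasureTheory Set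
open scoped ENNReal RealInnerProductSpace

noncomputable section

namespace Cosserat

/-- Euclidean `d`-space. -/
abbrev Pt (d : ℕ) := EuclideanSpace ℝ (Fin d)

/-- An `m`-tuple of vector fields on `ℝ^d`, i.e. a tensor field whose divergence is taken
separately in each of its `m` vector components: the stress has `m = d` of them, the couple stress
`m = d.choose 2`. -/
abbrev TensorField (d m : ℕ) := Fin m → Pt d → Pt d

/-! ### Weak derivatives -/

/-- Smooth compactly supported test functions on `ℝ^d`. -/
def IsTest {d : ℕ} (φ : Pt d → ℝ) : Prop := ContDiff ℝ (⊤ : ℕ∞) φ ∧ HasCompactSupport φ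

/-- `g` is the weak partial derivative `∂_i f` on the open set `U`. -/
def HasWeakPartial {d : ℕ} (U : Set (Pt d)) (i : Fin d) (f g : Pt d → ℝ) : Prop :=
  ∀ φ : Pt d → ℝ, IsTest φ → tsupport φ ⊆ U →
    ∫ x in U, f x * fderiv ℝ φ x (EuclideanSpace.single i 1) = -∫ x in U, g x * φ x

/-- The Sobolev space `W^{k,∞}(U)`: all weak derivatives of order at most `k` are in `L^∞(U)`. -/
def MemSobolevInf {d : ℕ} (U : Set (Pt d)) : ℕ → (Pt d → ℝ) → Prop
  | 0, f => MemLp f ∞ (volume.restrict U)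
  | k + 1, f => MemLp f ∞ (volume.restrict U) ∧
      ∀ i : Fin d, ∃ g : Pt d → ℝ, HasWeakPartial U i f g ∧ MemSobolevInf U k g

/-- `g` is the weak divergence of the vector field `v` on the open set `Ω`.
Note that `fderiv ℝ φ x (v x) = v x ⬝ ∇φ x`. -/
def HasWeakDiv {d : ℕ} (Ω : Set (Pt d)) (v : Pt d → Pt d) (g : Pt d → ℝ) : Prop :=
  ∀ φ : Pt d → ℝ, IsTest φ → tsupport φ ⊆ Ω →
    ∫ x in Ω, fderiv ℝ φ x (v x) = -∫ x in Ω, g x * φ x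

/-- The square-integrable `ℝ^m`-valued functions on `Ω` (modulo equality a.e.). -/
abbrev L2 {d : ℕ} (Ω : Set (Pt d)) (F : Type*) [NormedAddCommGroup F] := Lp F 2 (volume.restrict Ω)

/-- The tensor field `τ` belongs to `H_div(Ω)`. -/
def MemHdiv {d m : ℕ} (Ω : Set (Pt d)) (τ : TensorField d m) : Prop :=
  (∀ k, MemLp (τ k) 2 (volume.restrict Ω)) ∧
    ∃ g : L2 Ω (EuclideanSpace ℝ (Fin m)), ∀ k, HasWeakDiv Ω (τ k) (fun x => g x k)

open Classical in
/-- The weak divergence `∇ ⬝ τ` of a tensor field that has one in `L²(Ω; ℝ^m)`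
(and `0` for other tensor fields). -/
def weakDiv {d m : ℕ} (Ω : Set (Pt d)) (τ : TensorField d m) : L2 Ω (EuclideanSpace ℝ (Fin m)) :=
  if h : ∃ g : L2 Ω (EuclideanSpace ℝ (Fin m)), ∀ k, HasWeakDiv Ω (τ k) (fun x => g x k)
  then h.choose else 0

theorem weakDiv_spec {d m : ℕ} {Ω : Set (Pt d)} {τ : TensorField d m} (h : MemHdiv Ω τ) (k : Fin m) :
    HasWeakDiv Ω (τ k) (fun x => weakDiv Ω τ x k) := by
  have h' := h.2
  unfold weakDiv
  rw [dif_pos h']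
  exact h'.choose_spec k

/-- The weak divergence is unique. -/
theorem weakDiv_eq {d m : ℕ} {Ω : Set (Pt d)} (hΩ : IsOpen Ω) {τ : TensorField d m}
    (g : L2 Ω (EuclideanSpace ℝ (Fin m))) (hg : ∀ k, HasWeakDiv Ω (τ k) (fun x => g x k)) :
    weakDiv Ω τ = g := by
  have h' : ∃ g : L2 Ω (EuclideanSpace ℝ (Fin m)), ∀ k, HasWeakDiv Ω (τ k) (fun x => g x k) :=
    ⟨g, hg⟩
  have hs : ∀ k, HasWeakDiv Ω (τ k) (fun x => weakDiv Ω τ x k) := by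
    unfold weakDiv
    rw [dif_pos h']
    exact h'.choose_spec
  set G := weakDiv Ω τ with hG
  have hloc : ∀ (f : L2 Ω (EuclideanSpace ℝ (Fin m))) (k : Fin m),
      LocallyIntegrableOn (fun x => f x k) Ω volume := by
    intro f k
    have h1 : MemLp (fun x => f x k) 2 (volume.restrict Ω) :=
      (Lp.memLp f).of_le
        ((EuclideanSpace.proj (𝕜 := ℝ) k).continuous.comp_aestronglyMeasurable
          (Lp.aestronglyMeasurable f))
        (Filter.Eventually.of_forall fun x => PiLp.norm_apply_le (f x) k)
    have h2 : LocallyIntegrable (fun x => f x k) (volume.restrict Ω) :=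
      h1.locallyIntegrable (by norm_num)
    exact locallyIntegrableOn_of_locallyIntegrable_restrict h2
  have key : ∀ k, ∀ᵐ x ∂volume, x ∈ Ω → (G x k - g x k) = 0 := by
    intro k
    refine hΩ.ae_eq_zero_of_integral_contDiff_smul_eq_zero ((hloc G k).sub (hloc g k)) ?_
    intro φ hφ hc hsup
    have hint : ∀ f : L2 Ω (EuclideanSpace ℝ (Fin m)),
        Integrable (fun x => φ x * f x k) volume := by
      intro f
      have h3 : IntegrableOn (fun x => f x k) (tsupport φ) volume :=
        (hloc f k).integrableOn_compact_subset hsup hc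
      have := (h3.bdd_mul (f := φ) (c := _) hφ.continuous.aestronglyMeasurable
        (Filter.Eventually.of_forall (hφ.continuous.bounded_above_of_compact_support hc).choose_spec))
      refine (integrableOn_iff_integrable_of_support_subset ?_).1 this
      intro x hx
      exact subset_tsupport φ (fun h0 => hx (by simp [h0]))
    have hres : ∀ f : L2 Ω (EuclideanSpace ℝ (Fin m)),
        ∫ x, φ x * f x k = ∫ x in Ω, f x k * φ x := by
      intro f
      rw [setIntegral_eq_integral_of_forall_compl_eq_zero]
      · simp_rw [mul_comm]
      · intro x hx
        rw [image_eq_zero_of_notMem_tsupport (fun h => hx (hsup h)), mul_zero]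
    simp only [smul_eq_mul, mul_sub]
    rw [integral_sub (hint G) (hint g), hres, hres]
    have e1 := hs k φ ⟨hφ, hc⟩ hsup
    have e2 := hg k φ ⟨hφ, hc⟩ hsup
    linarith
  apply Lp.ext
  have hall : ∀ᵐ x ∂volume, ∀ k, x ∈ Ω → (G x k - g x k) = 0 := ae_all_iff.2 key
  filter_upwards [ae_restrict_of_ae hall, ae_restrict_mem hΩ.measurableSet] with x hx hxΩ
  ext k
  exact sub_eq_zero.1 (hx k hxΩ)

/-- The weak form of `n ⬝ τ = 0` on the part `Γ` of `∂Ω`: integration by parts has no boundary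
term for test functions that vanish near `∂Ω \ Γ`. -/
def NormalTraceVanishesOn {d m : ℕ} (Ω Γ : Set (Pt d)) (τ : TensorField d m) : Prop :=
  ∀ k, ∀ φ : Pt d → ℝ, IsTest φ → Disjoint (tsupport φ) (frontier Ω \ Γ) →
    ∫ x in Ω, fderiv ℝ φ x (τ k x) = -∫ x in Ω, weakDiv Ω τ x k * φ x

/-! ### The Sobolev spaces and the length scale -/

/-- The stress space `Σ`. -/
def stressSpace {d : ℕ} (Ω Γ : Set (Pt d)) : Set (TensorField d d) :=
  {σ | MemHdiv Ω σ ∧ NormalTraceVanishesOn Ω Γ σ}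

/-- The product `ℓ ω`. -/
def scaled {d m : ℕ} (ℓ : Pt d → ℝ) (ω : TensorField d m) : TensorField d m :=
  fun k x => ℓ x • ω k x

/-- The couple stress space `W`. -/
def coupleStressSpace {d : ℕ} (Ω Γ : Set (Pt d)) (ℓ : Pt d → ℝ) :
    Set (TensorField d (d.choose 2)) :=
  {ω | (∀ k, MemLp (ω k) 2 (volume.restrict Ω)) ∧
    MemHdiv Ω (scaled ℓ ω) ∧ NormalTraceVanishesOn Ω Γ (scaled ℓ ω)}

/-- `ℓ` is an admissible length scale: continuous, nonnegative, with
`‖ℓ‖_{L^∞(Ω)} + ‖∇ℓ‖_{L^∞(Ω)} ≤ L`, where `∇ℓ` is the weak gradient. -/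
structure IsLengthScale {d : ℕ} (Ω : Set (Pt d)) (L : ℝ) (ℓ : Pt d → ℝ) : Prop where
  continuousOn : ContinuousOn ℓ Ω
  nonneg : ∀ x ∈ Ω, 0 ≤ ℓ x
  bound : ∃ G : Pt d → Pt d, MemLp G ∞ (volume.restrict Ω) ∧
    (∀ i, HasWeakPartial Ω i ℓ (fun x => G x i)) ∧
    eLpNorm ℓ ∞ (volume.restrict Ω) + eLpNorm G ∞ (volume.restrict Ω) ≤ ENNReal.ofReal L

/-! ### Simplicial meshes -/

/-- A simplicial mesh: a finite geometric simplicial complex all of whose faces are faces of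
`d`-dimensional simplices. Simplices are given by their vertex sets. -/
structure SimplicialMesh (d : ℕ) where
  complex : Geometry.SimplicialComplex ℝ (Pt d)
  finite : complex.faces.Finite
  pure : ∀ s ∈ complex.faces, ∃ t ∈ complex.faces, s ⊆ t ∧ t.card = d + 1

namespace SimplicialMesh

variable {d : ℕ} (M : SimplicialMesh d)

/-- The elements of the mesh (the `d`-dimensional simplices), given by their node sets. -/
def Elem : Type := {s : Finset (Pt d) // s ∈ M.complex.faces ∧ s.card = d + 1}

/-- The node set of an element. -/
def Elem.nodes {M : SimplicialMesh d} (T : M.Elem) : Finset (Pt d) := T.1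

/-- The closed simplex `Δ`. -/
def Elem.cell {M : SimplicialMesh d} (T : M.Elem) : Set (Pt d) :=
  convexHull ℝ (T.nodes : Set (Pt d))

/-- The domain `Ω` tessellated by the mesh: the interior of the union of the closed simplices.
(A Lipschitz domain is the interior of its closure.) -/
def domain : Set (Pt d) := interior M.complex.space

/-- Shape regularity with parameter `γ`: every element `Δ` contains a ball whose radius is at
least `diam Δ / γ`. -/
def ShapeRegular (γ : ℝ) : Prop :=
  ∀ T : M.Elem, ∃ (c : Pt d) (ρ : ℝ), 0 < ρ ∧ Metric.ball c ρ ⊆ T.cell ∧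
    Metric.diam T.cell ≤ γ * ρ

instance : Finite M.Elem :=
  Set.Finite.to_subtype (M.finite.subset fun _ hs => hs.1)

instance : Fintype M.Elem := Fintype.ofFinite _

/-! ### Piecewise linear functions -/

/-- The space `P_1` of (discontinuous) piecewise linear `F`-valued functions on the mesh: one
affine function for each element. -/
abbrev P1 (F : Type*) [NormedAddCommGroup F] [InnerProductSpace ℝ F] :=
  M.Elem → (Pt d →ᵃ[ℝ] F)

variable {M} {F : Type*} [NormedAddCommGroup F] [InnerProductSpace ℝ F]

/-- The function on `Ω` (defined almost everywhere) given by an element of `P_1`. -/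
def P1.toFun (a : M.P1 F) (x : Pt d) : F :=
  ∑ T : M.Elem, (interior T.cell).indicator (a T) x

variable (M F) in
/-- The Lagrange space `L_1` of continuous piecewise linear functions, as a subspace of `P_1`. -/
def L1 : Submodule ℝ (M.P1 F) where
  carrier := {a | ∃ f : Pt d → F, ContinuousOn f M.complex.space ∧
    ∀ T : M.Elem, ∀ x ∈ T.cell, f x = a T x}
  add_mem' := by
    rintro a b ⟨f, hf, hfa⟩ ⟨g, hg, hgb⟩
    exact ⟨f + g, hf.add hg, fun T x hx => by simp [hfa T x hx, hgb T x hx]⟩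
  zero_mem' := ⟨0, continuousOn_const, fun T x _ => by simp⟩
  smul_mem' := by
    rintro c a ⟨f, hf, hfa⟩
    exact ⟨c • f, hf.const_smul c, fun T x hx => by simp [hfa T x hx]⟩

/-- `BDM_1`: the piecewise linear vector fields that belong to `H_div(Ω)`. -/
def BDM1 (M : SimplicialMesh d) : Set (Pt d → Pt d) :=
  {v | (∃ a : M.P1 (Pt d), v =ᵐ[volume.restrict M.domain] a.toFun) ∧
    MemHdiv M.domain (fun _ : Fin 1 => v)}

/-- `Σ_h = BDM_1^d ∩ Σ`. -/
def stressFE (M : SimplicialMesh d) (Γ : Set (Pt d)) : Set (TensorField d d) :=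
  {σ | (∀ k, σ k ∈ M.BDM1) ∧ σ ∈ stressSpace M.domain Γ}

/-- `W_h = BDM_1^{k_d} ∩ W`. -/
def coupleStressFE (M : SimplicialMesh d) (Γ : Set (Pt d)) (ℓ : Pt d → ℝ) :
    Set (TensorField d (d.choose 2)) :=
  {ω | (∀ k, ω k ∈ M.BDM1) ∧ ω ∈ coupleStressSpace M.domain Γ ℓ}

/-! ### Auxiliary facts on elements -/

theorem Elem.affineIndependent (T : M.Elem) :
    AffineIndependent ℝ ((↑) : T.nodes → Pt d) := M.complex.indep T.2.1

theorem Elem.affineSpan_eq_top (T : M.Elem) : affineSpan ℝ (T.nodes : Set (Pt d)) = ⊤ := by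
  have h := (T.affineIndependent.affineSpan_eq_top_iff_card_eq_finrank_add_one).2 (by
    simpa using (show T.nodes.card = d + 1 from T.2.2))
  simpa using h

theorem Elem.interior_nonempty (T : M.Elem) : (interior T.cell).Nonempty :=
  interior_convexHull_nonempty_iff_affineSpan_eq_top.2 T.affineSpan_eq_top

theorem Elem.isCompact (T : M.Elem) : IsCompact T.cell :=
  T.nodes.finite_toSet.isCompact_convexHull (𝕜 := ℝ)

theorem Elem.interior_subset_domain (T : M.Elem) : interior T.cell ⊆ M.domain :=
  interior_mono (M.complex.convexHull_subset_space T.2.1)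

theorem Elem.eq_of_mem_interior {S T : M.Elem} {x : Pt d} (hS : x ∈ interior S.cell)
    (hT : x ∈ interior T.cell) : S = T := by
  classical
  have hsub : interior S.cell ∩ interior T.cell ⊆
      convexHull ℝ ((S.nodes ∩ T.nodes : Finset (Pt d)) : Set (Pt d)) := by
    intro y hy
    have := M.complex.inter_subset_convexHull S.2.1 T.2.1
      ⟨interior_subset hy.1, interior_subset hy.2⟩
    rw [Finset.coe_inter]
    exact this
  have hne : (interior (convexHull ℝ
      ((S.nodes ∩ T.nodes : Finset (Pt d)) : Set (Pt d)))).Nonempty :=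
    ⟨x, mem_interior.2 ⟨_, hsub, isOpen_interior.inter isOpen_interior, hS, hT⟩⟩
  have hspan := interior_convexHull_nonempty_iff_affineSpan_eq_top.1 hne
  have hind : AffineIndependent ℝ ((↑) : (S.nodes ∩ T.nodes : Finset (Pt d)) → Pt d) :=
    S.affineIndependent.mono (by simp)
  have hcard := (hind.affineSpan_eq_top_iff_card_eq_finrank_add_one).1 (by
    rw [Subtype.range_coe_subtype]; exact hspan)
  simp only [Fintype.card_coe, finrank_euclideanSpace, Fintype.card_fin] at hcard
  have h1 : S.nodes ∩ T.nodes = S.nodes :=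
    Finset.eq_of_subset_of_card_le Finset.inter_subset_left (by rw [hcard]; exact S.2.2.le)
  have h2 : S.nodes ∩ T.nodes = T.nodes :=
    Finset.eq_of_subset_of_card_le Finset.inter_subset_right (by rw [hcard]; exact T.2.2.le)
  exact Subtype.ext (h1.symm.trans h2)

theorem P1.toFun_of_mem (a : M.P1 F) {T : M.Elem} {x : Pt d} (hx : x ∈ interior T.cell) :
    a.toFun x = a T x := by
  unfold P1.toFun
  rw [Finset.sum_eq_single T]
  · exact indicator_of_mem hx _
  · intro S _ hST
    exact indicator_of_notMem (fun hS => hST (Elem.eq_of_mem_interior hS hx)) _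
  · simp

theorem P1.continuous (a : M.P1 F) (T : M.Elem) : Continuous (a T) :=
  AffineMap.continuous_of_finiteDimensional _

theorem P1.memLp (a : M.P1 F) : MemLp a.toFun 2 (volume.restrict M.domain) := by
  have : a.toFun = ∑ T : M.Elem, (interior T.cell).indicator (a T) := by
    ext x; simp [P1.toFun]
  rw [this]
  refine memLp_finsetSum' _ fun T _ => ?_
  have hm : MeasurableSet (interior T.cell) := isOpen_interior.measurableSet
  refine (memLp_indicator_iff_restrict hm).2 ?_
  obtain ⟨C, hC⟩ := T.isCompact.exists_bound_of_continuousOn (P1.continuous a T).continuousOn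
  have hfin : IsFiniteMeasure ((volume.restrict M.domain).restrict (interior T.cell)) := by
    refine ⟨?_⟩
    rw [Measure.restrict_apply_univ]
    exact ((Measure.restrict_apply_le _ _).trans (measure_mono interior_subset)).trans_lt
      T.isCompact.measure_lt_top
  refine MemLp.of_bound (P1.continuous a T).aestronglyMeasurable C ?_
  filter_upwards [ae_restrict_mem hm] with x hx
  exact hC x (interior_subset hx)

variable (M F) in
/-- The inclusion of `P_1` in `L²(Ω)`. -/
def P1.toL2 : M.P1 F →ₗ[ℝ] L2 M.domain F where
  toFun a := (P1.memLp a).toLp a.toFun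
  map_add' a b := by
    rw [← MemLp.toLp_add]
    congr 1
    ext x
    simp only [P1.toFun, Pi.add_apply, ← Finset.sum_add_distrib]
    refine Finset.sum_congr rfl fun T _ => ?_
    by_cases hx : x ∈ interior T.cell <;> simp [hx]
  map_smul' c a := by
    rw [RingHom.id_apply, ← MemLp.toLp_const_smul]
    congr 1
    ext x
    simp only [P1.toFun, Pi.smul_apply, Finset.smul_sum]
    refine Finset.sum_congr rfl fun T _ => ?_
    by_cases hx : x ∈ interior T.cell <;> simp [hx]

theorem P1.toL2_injective : Function.Injective (P1.toL2 M F) := by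
  rw [← LinearMap.ker_eq_bot, LinearMap.ker_eq_bot']
  intro a ha
  have h0 : a.toFun =ᵐ[volume.restrict M.domain] 0 := by
    have h1 := MemLp.coeFn_toLp (P1.memLp a)
    have h2 : (P1.memLp a).toLp a.toFun = 0 := ha
    rw [h2] at h1
    exact h1.symm.trans (Lp.coeFn_zero _ _ _)
  funext T
  have h1 : (a T : Pt d → F) =ᵐ[volume.restrict (interior T.cell)] (fun _ => 0) := by
    filter_upwards [ae_restrict_of_ae_restrict_of_subset T.interior_subset_domain h0,
      ae_restrict_mem isOpen_interior.measurableSet] with x hx hxT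
    rw [← P1.toFun_of_mem a hxT, hx]; rfl
  have h2 : EqOn (a T) (fun _ => 0) (interior T.cell) :=
    Measure.eqOn_open_of_ae_eq h1 isOpen_interior (P1.continuous a T).continuousOn
      continuousOn_const
  have hspan : affineSpan ℝ (interior T.cell) = ⊤ :=
    isOpen_interior.affineSpan_eq_top T.interior_nonempty
  refine AffineMap.ext_on hspan (f := a T) (g := 0) ?_
  intro x hx
  simpa using h2 hx

/-! ### The projections -/

/-- A positive definite bilinear form on a finite-dimensional space is nondegenerate. -/
theorem nondegenerate_of_definite {V : Type*} [AddCommGroup V] [Module ℝ V]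
    (B : LinearMap.BilinForm ℝ V) (hB : ∀ v, B v v = 0 → v = 0) : B.Nondegenerate :=
  ⟨fun v hv => hB v (hv v), fun v hv => hB v (hv v)⟩

variable (M F) in
/-- The `L²(Ω)`-inner product on `P_1`. -/
def l2Form : LinearMap.BilinForm ℝ (M.P1 F) :=
  (innerₗ (L2 M.domain F)).compl₁₂ (P1.toL2 M F) (P1.toL2 M F)

theorem l2Form_definite (a : M.P1 F) (h : l2Form M F a a = 0) : a = 0 := by
  apply P1.toL2_injective
  rw [map_zero]
  exact inner_self_eq_zero (𝕜 := ℝ).1 h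

variable (M F) in
/-- The inner product `(⬝, ⬝)_{Q_1}` on `P_1`, given by the vertex quadrature rule. -/
def q1Form : LinearMap.BilinForm ℝ (M.P1 F) :=
  LinearMap.mk₂ ℝ
    (fun a b => ∑ T : M.Elem, volume.real T.cell / (d + 1) * ∑ x ∈ T.nodes, ⟪a T x, b T x⟫)
    (by intro a a' b; simp [inner_add_left, Finset.sum_add_distrib, mul_add])
    (by intro c a b; simp [real_inner_smul_left, Finset.mul_sum, mul_left_comm])
    (by intro a b b'; simp [inner_add_right, Finset.sum_add_distrib, mul_add])
    (by intro c a b; simp [real_inner_smul_right, Finset.mul_sum, mul_left_comm])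

theorem q1Form_apply (a b : M.P1 F) : q1Form M F a b =
    ∑ T : M.Elem, volume.real T.cell / (d + 1) * ∑ x ∈ T.nodes, ⟪a T x, b T x⟫ := rfl

theorem q1Form_definite (a : M.P1 F) (h : q1Form M F a a = 0) : a = 0 := by
  rw [q1Form_apply] at h
  have hin : ∀ T : M.Elem, ∀ x ∈ T.nodes, 0 ≤ ⟪a T x, a T x⟫ :=
    fun T x _ => real_inner_self_nonneg
  have hnn : ∀ T ∈ (Finset.univ : Finset M.Elem),
      0 ≤ volume.real T.cell / (d + 1) * ∑ x ∈ T.nodes, ⟪a T x, a T x⟫ := fun T _ =>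
    mul_nonneg (by positivity) (Finset.sum_nonneg (hin T))
  funext T
  have hT := (Finset.sum_eq_zero_iff_of_nonneg hnn).1 h T (Finset.mem_univ T)
  have hvol : 0 < volume.real T.cell := by
    refine ENNReal.toReal_pos ?_ T.isCompact.measure_lt_top.ne
    exact ((isOpen_interior.measure_pos volume T.interior_nonempty).trans_le
      (measure_mono interior_subset)).ne'
  have hsum : ∑ x ∈ T.nodes, ⟪a T x, a T x⟫ = 0 := by
    rcases mul_eq_zero.1 hT with h0 | h0
    · exact absurd h0 (by positivity)
    · exact h0
  refine AffineMap.ext_on T.affineSpan_eq_top (f := a T) (g := 0) ?_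
  intro x hx
  have := (Finset.sum_eq_zero_iff_of_nonneg (hin T)).1 hsum x hx
  simpa using inner_self_eq_zero (𝕜 := ℝ).1 this

variable [FiniteDimensional ℝ F]

/-- The linear functional `a ↦ (g, a)_Ω` on `P_1`. -/
def pairing (g : L2 M.domain F) : Module.Dual ℝ (M.P1 F) :=
  (innerₗ (L2 M.domain F) g).comp (P1.toL2 M F)

/-- The element `p` of the subspace `V` of `P_1` with `B(p, v) = f(v)` for all `v ∈ V`, where
`B` is a positive definite form on `P_1`. -/
def projOn (B : LinearMap.BilinForm ℝ (M.P1 F)) (hB : ∀ a, B a a = 0 → a = 0)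
    (V : Submodule ℝ (M.P1 F)) (f : Module.Dual ℝ (M.P1 F)) : M.P1 F :=
  ((B.restrict V).toDual (nondegenerate_of_definite _ fun v hv =>
    Subtype.ext (hB v hv))).symm (f.comp V.subtype)

/-- The `L²`-projection `Π_1` onto `P_1`. -/
def proj1 (g : L2 M.domain F) : M.P1 F := projOn (l2Form M F) l2Form_definite ⊤ (pairing g)

/-- The `L²`-projection `Π_R` onto `R_h = L_1`. -/
def projR (g : L2 M.domain F) : M.P1 F :=
  projOn (l2Form M F) l2Form_definite (L1 M F) (pairing g)

/-- The projection `Π_R^Q` onto `R_h = L_1` that is orthogonal for the `Q_1`-inner product: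
`(Π_R^Q g, r)_{Q_1} = (Π_1 g, r)_{Q_1}` for all `r ∈ R_h`. -/
def projRQ (g : L2 M.domain F) : M.P1 F :=
  projOn (q1Form M F) q1Form_definite (L1 M F) (q1Form M F (proj1 g))

theorem projOn_mem (B : LinearMap.BilinForm ℝ (M.P1 F)) (hB : ∀ a, B a a = 0 → a = 0)
    (V : Submodule ℝ (M.P1 F)) (f : Module.Dual ℝ (M.P1 F)) : projOn B hB V f ∈ V :=
  Subtype.prop _

theorem projOn_spec (B : LinearMap.BilinForm ℝ (M.P1 F)) (hB : ∀ a, B a a = 0 → a = 0)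
    (V : Submodule ℝ (M.P1 F)) (f : Module.Dual ℝ (M.P1 F)) {v : M.P1 F} (hv : v ∈ V) :
    B (projOn B hB V f) v = f v :=
  LinearMap.BilinForm.apply_toDual_symm_apply (B := B.restrict V)
    (hB := nondegenerate_of_definite _ fun v hv => Subtype.ext (hB v hv))
    (f.comp V.subtype) ⟨v, hv⟩

theorem projR_spec (g : L2 M.domain F) : projR g ∈ L1 M F ∧
    ∀ r ∈ L1 M F, ⟪P1.toL2 M F (projR g), P1.toL2 M F r⟫ = ⟪g, P1.toL2 M F r⟫ :=
  ⟨projOn_mem _ _ _ _, fun _ hr => projOn_spec (l2Form M F) l2Form_definite _ (pairing g) hr⟩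

theorem projRQ_spec (g : L2 M.domain F) : projRQ g ∈ L1 M F ∧
    ∀ r ∈ L1 M F, q1Form M F (projRQ g) r = q1Form M F (proj1 g) r :=
  ⟨projOn_mem _ _ _ _, fun _ hr => projOn_spec _ _ _ _ hr⟩

/-! ### The discrete norms -/

/-- `‖τ‖_Ω²` for a tensor field `τ`. -/
def normSq {d m : ℕ} (Ω : Set (Pt d)) (τ : TensorField d m) : ℝ := ∑ k, ∫ x in Ω, ‖τ k x‖ ^ 2

/-- The norm `‖(σ, ω)‖_{X_h}`, defined with the `L²`-projection `Π_R`. -/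
def normXh (M : SimplicialMesh d) (ℓ : Pt d → ℝ) (σ : TensorField d d)
    (ω : TensorField d (d.choose 2)) : ℝ :=
  √(normSq M.domain σ + ‖weakDiv M.domain σ‖ ^ 2 + normSq M.domain ω +
    ‖P1.toL2 M _ (projR (weakDiv M.domain (scaled ℓ ω)))‖ ^ 2)

/-- The norm `‖(σ, ω)‖_{X_Q}`, defined with the quadrature-based projection `Π_R^Q`. -/
def normXQ (M : SimplicialMesh d) (ℓ : Pt d → ℝ) (σ : TensorField d d)
    (ω : TensorField d (d.choose 2)) : ℝ :=
  √(normSq M.domain σ + ‖weakDiv M.domain σ‖ ^ 2 + normSq M.domain ω +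
    ‖P1.toL2 M _ (projRQ (weakDiv M.domain (scaled ℓ ω)))‖ ^ 2)

end SimplicialMesh

end Cosserat

end

/-! Only the last terms of the two norms differ, so with `g = ∇·(ℓω)` one has to compare `‖Π_R g‖`
and `‖Π_R^Q g‖` up to a multiple of `‖ω‖`.

By symmetry the second moments of barycentric coordinates on any `d`-simplex are `|Δ| (α δ_ij + β)`,
with `α > 0` and `β ≥ 0` depending only on `d` (`exists_moments`). Hence the vertex rule and the
`L²` product are equivalent on `P_1`, and `(a, r)_{Q_1} = (a, r) + c (a, r°)`, where `c = β (d + 1)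
/ α` and `r°` is `r` minus its elementwise mean (`q1Form_eq`). For `r ∈ R_h` this gives `(Π_R^Q g,
r)_{Q_1} = (Π_R g, r) + c (g, r°)`.

The decisive point is that `(g, r°)` is bounded by `‖ω‖ ‖r°‖`, although `‖g‖` is not bounded by
`‖ω‖` uniformly in the mesh. On an element `g = ∇ℓ·ω + ℓ ∇·ω`, and `∇·ω` is constant there. Since
`r°` has mean zero, `ℓ` may be replaced by `ℓ - ℓ(x₀)`, which is at most `L diam Δ` because a
bounded weak gradient makes `ℓ` Lipschitz on the convex element (`abs_sub_le_of_hasWeakPartial`).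
The inverse inequality `abs_affineDiv_le` costs a factor `1/ρ`, and shape regularity bounds `diam Δ
/ ρ` (`local_bound`, `abs_l2Form_proj1_weakDiv_le`).

Taking `r = Π_R^Q g` and `r = Π_R g` and absorbing the terms in `r` gives the two inequalities
(`norm_projRQ_sq_le`, `norm_projR_sq_le`). -/

set_option linter.unusedSectionVars false

/-! ### Second moments of barycentric coordinates on a simplex. -/

namespace AffineBasis

variable {E ι : Type*} [NormedAddCommGroup E] [NormedSpace ℝ E] [Fintype ι]

/-- The affine map that sends the vertices of one affine basis to those of another. -/
noncomputable def transport (b b' : AffineBasis ι ℝ E) : E →ᵃ[ℝ] E where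
  toFun x := ∑ i, b.coord i x • b' i
  linear := ∑ i, (b.coord i).linear.smulRight (b' i)
  map_vadd' x v := by
    have h : ∀ i, b.coord i (v + x) = (b.coord i).linear v + b.coord i x := fun i =>
      (b.coord i).map_vadd x v
    simp only [vadd_eq_add, h, add_smul, Finset.sum_add_distrib, LinearMap.sum_apply,
      LinearMap.smulRight_apply]

theorem transport_apply (b b' : AffineBasis ι ℝ E) (x : E) :
    b.transport b' x = ∑ i, b.coord i x • b' i := rfl

theorem coord_transport (b b' : AffineBasis ι ℝ E) (i : ι) (x : E) :
    b'.coord i (b.transport b' x) = b.coord i x := by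
  rw [transport_apply, ← Finset.affineCombination_eq_linear_combination _ _ _
    (b.sum_coord_apply_eq_one x)]
  exact b'.coord_apply_combination_of_mem (Finset.mem_univ i) (b.sum_coord_apply_eq_one x)

theorem transport_transport (b b' : AffineBasis ι ℝ E) (x : E) :
    b'.transport b (b.transport b' x) = x :=
  b.ext_elem fun i => by rw [coord_transport, coord_transport]

/-- The closed simplex spanned by an affine basis. -/
def hull (b : AffineBasis ι ℝ E) : Set E := convexHull ℝ (range b)

theorem mem_hull (b : AffineBasis ι ℝ E) {x : E} : x ∈ b.hull ↔ ∀ i, 0 ≤ b.coord i x := by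
  rw [hull, convexHull_eq_nonneg_coord]; rfl

theorem image_hull (b b' : AffineBasis ι ℝ E) : b.transport b' '' b.hull = b'.hull := by
  ext y
  constructor
  · rintro ⟨x, hx, rfl⟩
    rw [mem_hull] at hx ⊢
    intro i
    rw [coord_transport]
    exact hx i
  · intro hy
    refine ⟨b'.transport b y, ?_, transport_transport b' b y⟩
    rw [mem_hull] at hy ⊢
    intro i
    rw [coord_transport]
    exact hy i

theorem isCompact_hull (b : AffineBasis ι ℝ E) : IsCompact b.hull :=
  (finite_range b).isCompact_convexHull (𝕜 := ℝ)

variable [FiniteDimensional ℝ E]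

theorem continuous_coord' (b : AffineBasis ι ℝ E) (i : ι) : Continuous (b.coord i) :=
  AffineMap.continuous_of_finiteDimensional _

theorem interior_hull_nonempty (b : AffineBasis ι ℝ E) : (interior b.hull).Nonempty :=
  interior_convexHull_nonempty_iff_affineSpan_eq_top.2 b.tot

/-- Every affine map is determined by its vertex values through barycentric coordinates. -/
theorem affineMap_apply_eq_sum {F : Type*} [AddCommGroup F] [Module ℝ F]
    (b : AffineBasis ι ℝ E) (a : E →ᵃ[ℝ] F) (x : E) :
    a x = ∑ i, b.coord i x • a (b i) := by
  conv_lhs => rw [← b.affineCombination_coord_eq_self x]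
  rw [Finset.map_affineCombination _ _ _ (b.sum_coord_apply_eq_one x),
    Finset.affineCombination_eq_linear_combination _ _ _ (b.sum_coord_apply_eq_one x)]
  rfl

variable [MeasurableSpace E] [BorelSpace E] (μ : Measure E) [μ.IsAddHaarMeasure]

theorem measurableSet_hull (b : AffineBasis ι ℝ E) : MeasurableSet b.hull :=
  b.isCompact_hull.measurableSet

theorem measure_hull_pos (b : AffineBasis ι ℝ E) : 0 < μ.real b.hull :=
  ENNReal.toReal_pos
    ((isOpen_interior.measure_pos μ b.interior_hull_nonempty).trans_le
      (measure_mono interior_subset)).ne' b.isCompact_hull.measure_lt_top.ne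

/-- The mean over the simplex of a function of the barycentric coordinates. -/
noncomputable def mean (b : AffineBasis ι ℝ E) (f : (ι → ℝ) → ℝ) : ℝ :=
  (μ.real b.hull)⁻¹ * ∫ x in b.hull, f (fun i => b.coord i x) ∂μ

/-- Means of functions of the barycentric coordinates do not depend on the simplex. -/
theorem mean_eq (b b' : AffineBasis ι ℝ E) (f : (ι → ℝ) → ℝ) : b.mean μ f = b'.mean μ f := by
  set F := b.transport b' with hF
  have hder : ∀ x ∈ b.hull, HasFDerivWithinAt F (LinearMap.toContinuousLinearMap F.linear)
      b.hull x := by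
    intro x _
    have h1 : HasFDerivAt (fun x => LinearMap.toContinuousLinearMap F.linear x + F 0)
        (LinearMap.toContinuousLinearMap F.linear) x :=
      (ContinuousLinearMap.hasFDerivAt _).add_const _
    have h2 : (F : E → E) = fun x => LinearMap.toContinuousLinearMap F.linear x + F 0 :=
      F.decomp
    rw [h2]
    exact h1.hasFDerivWithinAt
  have hinj : InjOn F b.hull := fun x _ y _ h => by
    rw [← transport_transport b b' x, ← transport_transport b b' y, ← hF, h]
  have hint := fun g : E → ℝ =>
    integral_image_eq_integral_abs_det_fderiv_smul μ b.measurableSet_hull hder hinj g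
  rw [hF, image_hull] at hint
  set D := |(LinearMap.toContinuousLinearMap (b.transport b').linear).det|
  -- The integrand `1` shows that the constant Jacobian `D` is the ratio of the volumes; it
  -- therefore cancels in the mean.
  have h1 := hint (fun _ => 1)
  have h2 := hint (fun x => f (fun i => b'.coord i x))
  simp only [coord_transport, smul_eq_mul, integral_const, mul_one, integral_const_mul,
    measureReal_restrict_apply_univ] at h1 h2
  have hb := b.measure_hull_pos μ
  have hb' := b'.measure_hull_pos μ
  have hD : D ≠ 0 := by
    intro h0
    rw [h0, mul_zero] at h1
    exact hb'.ne' h1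
  rw [mean, mean, h1, h2]
  field_simp

theorem hull_reindex (b : AffineBasis ι ℝ E) (π : ι ≃ ι) : (b.reindex π).hull = b.hull := by
  rw [hull, hull, coe_reindex, EquivLike.range_comp]

/-- Relabelling the vertices permutes the coordinates but keeps the simplex, so independence of the
simplex turns into symmetry under permutations. -/
theorem mean_comp_perm (b : AffineBasis ι ℝ E) (π : ι ≃ ι) (f : (ι → ℝ) → ℝ) :
    b.mean μ (fun v => f (v ∘ π)) = b.mean μ f := by
  rw [mean_eq μ b (b.reindex π.symm) f, mean, mean, hull_reindex]
  simp only [coord_reindex]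
  rfl

theorem integrableOn_hull (b : AffineBasis ι ℝ E) {F : Type*} [NormedAddCommGroup F]
    {f : E → F} (hf : Continuous f) : IntegrableOn f b.hull μ :=
  hf.continuousOn.integrableOn_compact b.isCompact_hull

theorem mean_sum (b : AffineBasis ι ℝ E) {κ : Type*} (s : Finset κ) (f : κ → (ι → ℝ) → ℝ)
    (hf : ∀ k ∈ s, Continuous (f k)) :
    b.mean μ (fun v => ∑ k ∈ s, f k v) = ∑ k ∈ s, b.mean μ (f k) := by
  simp only [mean]
  rw [integral_finsetSum, Finset.mul_sum]
  intro k hk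
  exact b.integrableOn_hull μ ((hf k hk).comp (continuous_pi fun i => b.continuous_coord' i))

/-- The second moments of the barycentric coordinates of a simplex: they have the form
`α δ_ij + β` with `α` and `β` depending only on the dimension. -/
theorem exists_moments [DecidableEq ι] [Nontrivial ι] (hcard : Fintype.card ι = Module.finrank ℝ E + 1) :
    ∃ α β : ℝ, 0 < α ∧ 0 ≤ β ∧ α + Fintype.card ι * β = 1 / Fintype.card ι ∧
      ∀ (b : AffineBasis ι ℝ E) (i j : ι), ∫ x in b.hull, b.coord i x * b.coord j x ∂μ =
        μ.real b.hull * ((if i = j then α else 0) + β) := by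
  obtain ⟨b⟩ := AffineBasis.exists_affineBasis_of_finiteDimensional (k := ℝ) (P := E) hcard
  obtain ⟨i₀, j₀, hij₀⟩ := exists_pair_ne ι
  have hvol := b.measure_hull_pos μ
  set m : ι → ι → ℝ := fun i j => b.mean μ (fun v => v i * v j) with hm
  have hperm : ∀ (π : ι ≃ ι) i j, m (π i) (π j) = m i j := fun π i j =>
    b.mean_comp_perm μ π (fun v => v i * v j)
  have hdiag : ∀ i, m i i = m i₀ i₀ := by
    intro i
    simpa using hperm (Equiv.swap i₀ i) i₀ i₀
  have hoff : ∀ i j, i ≠ j → m i j = m i₀ j₀ := by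
    intro i j hij
    -- Two transpositions carry `(i₀, j₀)` to `(i, j)`: the first moves `i₀` to `i` and `j₀` to some
    -- `k ≠ i`, the second moves `k` to `j` and fixes `i`.
    have h1 := hperm (Equiv.swap i₀ i) i₀ j₀
    rw [Equiv.swap_apply_left] at h1
    set k := Equiv.swap i₀ i j₀ with hk
    have hki : k ≠ i := by
      intro h
      rw [hk, Equiv.swap_apply_eq_iff, Equiv.swap_apply_right] at h
      exact hij₀ h.symm
    have h2 := hperm (Equiv.swap k j) i k
    rw [Equiv.swap_apply_left, Equiv.swap_apply_of_ne_of_ne hki.symm hij] at h2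
    rw [h2, h1]
  have hmij : ∀ i j, m i j = (if i = j then m i₀ i₀ - m i₀ j₀ else 0) + m i₀ j₀ := by
    intro i j
    split_ifs with h
    · rw [← h, hdiag]; ring
    · rw [hoff i j h]; ring
  refine ⟨m i₀ i₀ - m i₀ j₀, m i₀ j₀, ?_, ?_, ?_, ?_⟩
  -- `α` is half the mean of the squared difference of two coordinates, which is why it is positive.
  · have hsq : m i₀ i₀ - m i₀ j₀ = (μ.real b.hull)⁻¹ *
        ∫ x in b.hull, (1 / 2 : ℝ) * (b.coord i₀ x - b.coord j₀ x) ^ 2 ∂μ := by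
      have hi : ∀ i j, IntegrableOn (fun x => b.coord i x * b.coord j x) b.hull μ := fun i j =>
        b.integrableOn_hull μ ((b.continuous_coord' i).mul (b.continuous_coord' j))
      have e : ∀ x, (1 / 2 : ℝ) * (b.coord i₀ x - b.coord j₀ x) ^ 2 =
          (1 / 2 * (b.coord i₀ x * b.coord i₀ x) + 1 / 2 * (b.coord j₀ x * b.coord j₀ x))
            - b.coord i₀ x * b.coord j₀ x := fun x => by ring
      simp only [e]
      have hs := integral_sub (((hi i₀ i₀).const_mul (1 / 2)).add ((hi j₀ j₀).const_mul (1 / 2)))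
        (hi i₀ j₀)
      simp only [Pi.add_apply] at hs
      rw [hs, integral_add ((hi _ _).const_mul _) ((hi _ _).const_mul _), integral_const_mul,
        integral_const_mul]
      have h2 := hdiag j₀
      simp only [hm, mean] at h2 ⊢
      linarith
    rw [hsq]
    refine mul_pos (inv_pos.2 hvol) ?_
    have hcont : Continuous fun x => (1 / 2 : ℝ) * (b.coord i₀ x - b.coord j₀ x) ^ 2 :=
      continuous_const.mul (((b.continuous_coord' i₀).sub (b.continuous_coord' j₀)).pow 2)
    have hnn : ∀ x, 0 ≤ (1 / 2 : ℝ) * (b.coord i₀ x - b.coord j₀ x) ^ 2 := fun x => by positivity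
    -- If the integral vanished, the two coordinates would agree on the interior, hence everywhere,
    -- contradicting their values `1` and `0` at vertex `i₀`.
    refine lt_of_le_of_ne (integral_nonneg hnn) fun h0 => ?_
    have h1 := (setIntegral_eq_zero_iff_of_nonneg_ae (Filter.Eventually.of_forall hnn)
      (b.integrableOn_hull μ hcont)).1 h0.symm
    have h2 : EqOn (fun x => (1 / 2 : ℝ) * (b.coord i₀ x - b.coord j₀ x) ^ 2) (fun _ => 0)
        (interior b.hull) :=
      Measure.eqOn_open_of_ae_eq (ae_restrict_of_ae_restrict_of_subset interior_subset h1)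
        isOpen_interior hcont.continuousOn continuousOn_const
    have hspan := isOpen_interior.affineSpan_eq_top b.interior_hull_nonempty
    have h3 : b.coord i₀ = b.coord j₀ := by
      refine AffineMap.ext_on hspan fun x hx => ?_
      have := h2 hx
      simp only [mul_eq_zero, pow_eq_zero_iff, ne_eq, OfNat.ofNat_ne_zero, not_false_eq_true] at this
      rcases this with h | h
      · norm_num at h
      · exact sub_eq_zero.1 h
    have h4 := b.coord_apply_eq i₀
    rw [h3, b.coord_apply_ne hij₀.symm] at h4
    exact zero_ne_one h4
  · refine mul_nonneg (inv_nonneg.2 hvol.le) (setIntegral_nonneg b.measurableSet_hull ?_)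
    intro x hx
    rw [mem_hull] at hx
    exact mul_nonneg (hx _) (hx _)
  -- The sum of all moments is the mean of the square of the coordinate sum, which is `1`.
  · have h1 : ∑ i, ∑ j, m i j = 1 := by
      have e : ∀ i, ∑ j, m i j = b.mean μ (fun v => ∑ j, v i * v j) := fun i =>
        (b.mean_sum μ _ _ fun j _ => by fun_prop).symm
      simp only [e]
      rw [← b.mean_sum μ _ _ fun j _ => by fun_prop, mean]
      have e2 : ∀ x, ∑ i, ∑ j, b.coord i x * b.coord j x = 1 := fun x => by
        rw [← Finset.sum_mul_sum, b.sum_coord_apply_eq_one, one_mul]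
      simp only [e2]
      simp only [integral_const, measureReal_restrict_apply_univ, smul_eq_mul, mul_one]
      exact inv_mul_cancel₀ hvol.ne'
    rw [Finset.sum_congr rfl fun i _ => Finset.sum_congr rfl fun j _ => hmij i j] at h1
    simp only [Finset.sum_add_distrib, Finset.sum_ite_eq, Finset.mem_univ, if_true,
      Finset.sum_const, Finset.card_univ, nsmul_eq_mul] at h1
    have hc : (Fintype.card ι : ℝ) ≠ 0 := by simp
    rw [eq_div_iff hc]
    linarith
  · intro b' i j
    have h := hmij i j
    have h2 : m i j = b'.mean μ (fun v => v i * v j) := mean_eq μ b b' _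
    rw [h2, mean, inv_mul_eq_iff_eq_mul₀ (b'.measure_hull_pos μ).ne'] at h
    exact h

/-- Integration of products of affine functions over a simplex, in terms of vertex values. -/
theorem integral_inner_eq [DecidableEq ι] {F : Type*} [NormedAddCommGroup F] [InnerProductSpace ℝ F]
    [FiniteDimensional ℝ F] {α β : ℝ} (b : AffineBasis ι ℝ E)
    (h : ∀ (i j : ι), ∫ x in b.hull, b.coord i x * b.coord j x ∂μ =
        μ.real b.hull * ((if i = j then α else 0) + β))
    (a c : E →ᵃ[ℝ] F) :
    ∫ x in b.hull, ⟪a x, c x⟫ ∂μ = μ.real b.hull *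
      (α * ∑ i, ⟪a (b i), c (b i)⟫ + β * ⟪∑ i, a (b i), ∑ i, c (b i)⟫) := by
  have e : ∀ x, ⟪a x, c x⟫ = ∑ i, ∑ j, b.coord i x * b.coord j x * ⟪a (b i), c (b j)⟫ := by
    intro x
    conv_lhs => rw [b.affineMap_apply_eq_sum a x, b.affineMap_apply_eq_sum c x]
    rw [sum_inner]
    refine Finset.sum_congr rfl fun i _ => ?_
    rw [inner_sum]
    refine Finset.sum_congr rfl fun j _ => ?_
    rw [real_inner_smul_left, real_inner_smul_right, mul_assoc]
  have hi : ∀ i j, IntegrableOn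
      (fun x => b.coord i x * b.coord j x * ⟪a (b i), c (b j)⟫) b.hull μ := fun i j =>
    b.integrableOn_hull μ
      (((b.continuous_coord' i).mul (b.continuous_coord' j)).mul continuous_const)
  rw [setIntegral_congr_fun b.measurableSet_hull fun x _ => e x,
    integral_finsetSum _ fun i _ => integrable_finsetSum _ fun j _ => hi i j]
  have e2 : ∀ i, ∫ x in b.hull, ∑ j, b.coord i x * b.coord j x * ⟪a (b i), c (b j)⟫ ∂μ =
      ∑ j, μ.real b.hull * ((if i = j then α else 0) + β) * ⟪a (b i), c (b j)⟫ := by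
    intro i
    rw [integral_finsetSum _ fun j _ => hi i j]
    refine Finset.sum_congr rfl fun j _ => ?_
    rw [integral_mul_const, h]
  rw [Finset.sum_congr rfl fun i _ => e2 i, sum_inner]
  simp only [inner_sum, mul_add, add_mul, Finset.sum_add_distrib, Finset.mul_sum,
    mul_ite, ite_mul, mul_zero, zero_mul, Finset.sum_ite_eq, Finset.mem_univ, if_true, mul_assoc]

end AffineBasis

/-! ### Localization of weak derivatives, and Lipschitz continuity from a bounded weak gradient. -/

namespace Cosserat

variable {d : ℕ}

theorem setIntegral_eq_of_tsupport_subset {U Ω : Set (Pt d)} (hUΩ : U ⊆ Ω) {f : Pt d → ℝ}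
    (hf : ∀ x ∉ U, f x = 0) : ∫ x in Ω, f x = ∫ x in U, f x := by
  rw [setIntegral_eq_integral_of_forall_compl_eq_zero fun x hx => hf x fun h => hx (hUΩ h),
    setIntegral_eq_integral_of_forall_compl_eq_zero hf]

theorem fderiv_eq_zero_of_notMem_tsupport {φ : Pt d → ℝ} {x : Pt d} (hx : x ∉ tsupport φ) :
    fderiv ℝ φ x = 0 := by
  have := support_fderiv_subset ℝ (f := φ)
  by_contra h
  exact hx (this h)

theorem HasWeakPartial.mono {U Ω : Set (Pt d)} (hUΩ : U ⊆ Ω) {i : Fin d} {f g : Pt d → ℝ}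
    (h : HasWeakPartial Ω i f g) : HasWeakPartial U i f g := by
  intro φ hφ hs
  have h1 := h φ hφ (hs.trans hUΩ)
  rwa [setIntegral_eq_of_tsupport_subset hUΩ, setIntegral_eq_of_tsupport_subset hUΩ] at h1
  · intro x hx
    rw [image_eq_zero_of_notMem_tsupport fun h => hx (hs h), mul_zero]
  · intro x hx
    rw [fderiv_eq_zero_of_notMem_tsupport fun h => hx (hs h)]
    simp

theorem HasWeakDiv.mono {U Ω : Set (Pt d)} (hUΩ : U ⊆ Ω) {v : Pt d → Pt d} {g : Pt d → ℝ}
    (h : HasWeakDiv Ω v g) : HasWeakDiv U v g := by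
  intro φ hφ hs
  have h1 := h φ hφ (hs.trans hUΩ)
  rwa [setIntegral_eq_of_tsupport_subset hUΩ, setIntegral_eq_of_tsupport_subset hUΩ] at h1
  · intro x hx
    rw [image_eq_zero_of_notMem_tsupport fun h => hx (hs h), mul_zero]
  · intro x hx
    rw [fderiv_eq_zero_of_notMem_tsupport fun h => hx (hs h)]
    simp

theorem eq_sum_single (v : Pt d) : v = ∑ i, v i • EuclideanSpace.single i (1 : ℝ) := by
  ext j
  simp [Pi.single_apply]

/-- A continuous function on a convex open set whose weak gradient is bounded by `L` is Lipschitz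
continuous with constant `L`. -/
theorem abs_sub_le_of_hasWeakPartial {U : Set (Pt d)} (hU : IsOpen U) (hconv : Convex ℝ U)
    {ℓ : Pt d → ℝ} (hℓ : ContinuousOn ℓ U) (hint : IntegrableOn ℓ U) {G : Pt d → Pt d}
    (hGint : IntegrableOn G U) {L : ℝ}
    (hG : ∀ i, HasWeakPartial U i ℓ (fun x => G x i))
    (hGL : ∀ᵐ x ∂(volume.restrict U), ‖G x‖ ≤ L) {x y : Pt d} (hx : x ∈ U) (hy : y ∈ U) :
    |ℓ x - ℓ y| ≤ L * ‖x - y‖ := by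
  classical
  refine le_of_forall_pos_le_add fun η hη => ?_
  have hKc : IsCompact (segment ℝ y x) := by
    rw [segment_eq_image_lineMap]
    exact isCompact_Icc.image (AffineMap.lineMap_continuous)
  obtain ⟨δ, hδ, hδU⟩ := hKc.exists_cthickening_subset_open hU (hconv.segment_subset hy hx)
  have hball : ∀ z ∈ segment ℝ y x, Metric.closedBall z δ ⊆ U := fun z hz =>
    (Metric.closedBall_subset_cthickening hz δ).trans hδU
  -- The function is extended by zero and mollified to `f`. The mean value inequality is applied to
  -- `f` on the segment, and each endpoint costs an error `η / 2`.
  set u := U.indicator ℓ with hu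
  have hu_int : Integrable u := (integrable_indicator_iff hU.measurableSet).2 hint
  have hcont : ∀ z ∈ U, ∃ r > 0, ∀ w ∈ Metric.ball z r, dist (u w) (u z) ≤ η / 2 := by
    intro z hz
    have h1 : ContinuousAt u z := by
      refine (hℓ.continuousAt (hU.mem_nhds hz)).congr ?_
      filter_upwards [hU.mem_nhds hz] with w hw
      exact (indicator_of_mem hw _).symm
    obtain ⟨r, hr, h⟩ := Metric.continuousAt_iff.1 h1 (η / 2) (by positivity)
    exact ⟨r, hr, fun w hw => (h hw).le⟩
  obtain ⟨r₁, hr₁, h₁⟩ := hcont x hx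
  obtain ⟨r₂, hr₂, h₂⟩ := hcont y hy
  -- The bound by `δ` keeps mollifiers centred on the segment supported in `U`; the bounds by `r₁`
  -- and `r₂` control the error at the endpoints.
  set ε := min δ (min r₁ r₂) with hε
  have hεpos : 0 < ε := lt_min hδ (lt_min hr₁ hr₂)
  let φ : ContDiffBump (0 : Pt d) := ⟨ε / 2, ε, by positivity, by linarith⟩
  set ψ := φ.normed volume with hψ
  have hψs : HasCompactSupport ψ := φ.hasCompactSupport_normed
  have hψc : ContDiff ℝ (⊤ : ℕ∞) ψ := φ.contDiff_normed
  set f := convolution ψ u (ContinuousLinearMap.lsmul ℝ ℝ) volume with hf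
  have hd1 : dist (f x) (u x) ≤ η / 2 :=
    φ.dist_normed_convolution_le hu_int.aestronglyMeasurable fun w hw =>
      h₁ w (Metric.ball_subset_ball ((min_le_right _ _).trans (min_le_left _ _)) hw)
  have hd2 : dist (f y) (u y) ≤ η / 2 :=
    φ.dist_normed_convolution_le hu_int.aestronglyMeasurable fun w hw =>
      h₂ w (Metric.ball_subset_ball ((min_le_right _ _).trans (min_le_right _ _)) hw)
  have hder : ∀ z, HasFDerivAt f (convolution (fderiv ℝ ψ) u
      ((ContinuousLinearMap.lsmul ℝ ℝ).precompL (Pt d)) volume z) z := fun z =>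
    hψs.hasFDerivAt_convolution_left _ (hψc.of_le (by exact_mod_cast le_top))
      hu_int.locallyIntegrable z
  have hL0 : 0 ≤ L := by
    have hpos : volume.restrict U ≠ 0 := by
      rw [Ne, Measure.restrict_eq_zero]
      exact (hU.measure_pos volume ⟨x, hx⟩).ne'
    have : (ae (volume.restrict U)).NeBot := ae_neBot.2 hpos
    obtain ⟨w, hw⟩ := hGL.exists
    exact (norm_nonneg _).trans hw
  have hbound : ∀ z ∈ segment ℝ y x, ‖convolution (fderiv ℝ ψ) u
      ((ContinuousLinearMap.lsmul ℝ ℝ).precompL (Pt d)) volume z‖ ≤ L := by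
    intro z hz
    set A := convolution (fderiv ℝ ψ) u
      ((ContinuousLinearMap.lsmul ℝ ℝ).precompL (Pt d)) volume z with hA
    -- The reflected mollifier is an admissible test function on `U`. Testing the weak gradient with
    -- it identifies the gradient of `f` at `z` with the average of `G` against `χ`, a nonnegative
    -- weight of integral `1`.
    set χ : Pt d → ℝ := fun t => ψ (z - t) with hχ
    have hχc : ContDiff ℝ (⊤ : ℕ∞) χ := hψc.comp (contDiff_const.sub contDiff_id)
    have hsupp : Function.support χ ⊆ Metric.closedBall z ε := by
      intro t ht
      have h3 : z - t ∈ Function.support ψ := ht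
      rw [hψ, φ.support_normed_eq] at h3
      have h4 : ‖z - t‖ < ε := by simpa using h3
      rw [Metric.mem_closedBall, dist_comm, dist_eq_norm]
      exact h4.le
    have htsupp : tsupport χ ⊆ Metric.closedBall z ε :=
      closure_minimal hsupp Metric.isClosed_closedBall
    have hχs : HasCompactSupport χ :=
      (isCompact_closedBall z ε).of_isClosed_subset (isClosed_tsupport χ) htsupp
    have htU : tsupport χ ⊆ U := htsupp.trans
      ((Metric.closedBall_subset_closedBall (min_le_left _ _)).trans (hball z hz))
    have hχder : ∀ t v, fderiv ℝ χ t v = - fderiv ℝ ψ (z - t) v := by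
      intro t v
      have h5 : HasFDerivAt ψ (fderiv ℝ ψ (z - t)) (z - t) :=
        (hψc.differentiable (by simp)).differentiableAt.hasFDerivAt
      have h6 : HasFDerivAt χ ((fderiv ℝ ψ (z - t)).comp (-ContinuousLinearMap.id ℝ (Pt d))) t :=
        h5.comp t ((hasFDerivAt_id t).const_sub z)
      rw [h6.fderiv]
      simp
    have hint1 : ∀ i : Fin d, Integrable (fun t => fderiv ℝ χ t (EuclideanSpace.single i 1) * u t) := by
      intro i
      have hc : Continuous fun t => fderiv ℝ χ t (EuclideanSpace.single i (1 : ℝ)) :=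
        (hχc.continuous_fderiv (by simp)).clm_apply continuous_const
      obtain ⟨C, hC⟩ := hc.bounded_above_of_compact_support (hχs.fderiv_apply ℝ _)
      exact hu_int.bdd_mul hc.aestronglyMeasurable (Filter.Eventually.of_forall hC)
    have hχb : ∃ C, ∀ t, ‖χ t‖ ≤ C := hχc.continuous.bounded_above_of_compact_support hχs
    have hχG : IntegrableOn (fun t => χ t • G t) U := by
      obtain ⟨C, hC⟩ := hχb
      exact Integrable.bdd_smul hGint C hχc.continuous.aestronglyMeasurable (Filter.Eventually.of_forall hC)
    have hAv : ∀ v, A v = ⟪∫ t in U, χ t • G t, v⟫ := by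
      intro v
      have hAi : A v = ∫ t, fderiv ℝ ψ (z - t) v * u t := by
        have hex := (hψs.fderiv ℝ).convolutionExists_left
          ((ContinuousLinearMap.lsmul ℝ ℝ).precompL (Pt d)) (hψc.continuous_fderiv (by simp))
          hu_int.locallyIntegrable z
        rw [hA, convolution_eq_swap, ContinuousLinearMap.integral_apply]
        · rfl
        · exact hex.integrable_swap
      have hpart : ∀ i : Fin d, ∫ t, fderiv ℝ χ t (EuclideanSpace.single i 1) * u t =
          - ∫ t in U, G t i * χ t := by
        intro i
        rw [← hG i χ ⟨hχc, hχs⟩ htU, ← integral_indicator hU.measurableSet]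
        congr 1
        ext t
        by_cases ht : t ∈ U <;> simp [hu, ht, mul_comm]
      have e1 : ∀ t, fderiv ℝ ψ (z - t) v * u t =
          - ∑ i, v i * (fderiv ℝ χ t (EuclideanSpace.single i 1) * u t) := by
        intro t
        conv_lhs => rw [eq_sum_single v]
        rw [map_sum, Finset.sum_mul, ← Finset.sum_neg_distrib]
        refine Finset.sum_congr rfl fun i _ => ?_
        rw [hχder, map_smul, smul_eq_mul]
        ring
      rw [hAi]
      simp only [e1]
      rw [integral_neg, integral_finsetSum _ fun i _ => (hint1 i).const_mul _]
      simp only [integral_const_mul, hpart]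
      rw [real_inner_comm, ← integral_inner hχG]
      have e2 : ∀ t, ⟪v, χ t • G t⟫ = ∑ i, v i * (G t i * χ t) := by
        intro t
        rw [real_inner_smul_right, PiLp.inner_apply, Finset.mul_sum]
        refine Finset.sum_congr rfl fun i _ => ?_
        simp
        ring
      simp only [e2]
      rw [integral_finsetSum]
      · simp [integral_const_mul]
      · intro i _
        refine Integrable.const_mul ?_ _
        have := (EuclideanSpace.proj (𝕜 := ℝ) i).integrable_comp hχG
        refine this.congr (Filter.Eventually.of_forall fun t => ?_)
        simp [mul_comm]
    refine ContinuousLinearMap.opNorm_le_bound _ hL0 fun v => ?_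
    rw [hAv]
    refine (norm_inner_le_norm _ _).trans (mul_le_mul_of_nonneg_right ?_ (norm_nonneg _))
    have hχint : ∫ t, χ t = 1 := by
      rw [hχ, integral_sub_left_eq_self ψ volume z]
      exact φ.integral_normed
    have hχnn : ∀ t, 0 ≤ χ t := fun t => φ.nonneg_normed _
    have hχi : Integrable χ := hχc.continuous.integrable_of_hasCompactSupport hχs
    calc ‖∫ t in U, χ t • G t‖ ≤ ∫ t in U, χ t * L := by
          refine norm_integral_le_of_norm_le (hχi.integrableOn.mul_const L) ?_
          filter_upwards [hGL] with t ht
          rw [norm_smul, Real.norm_of_nonneg (hχnn t)]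
          exact mul_le_mul_of_nonneg_left ht (hχnn t)
      _ ≤ ∫ t, χ t * L := setIntegral_le_integral (hχi.mul_const L)
          (Filter.Eventually.of_forall fun t => mul_nonneg (hχnn t) hL0)
      _ = L := by rw [integral_mul_const, hχint, one_mul]
  have hfl := (convex_segment y x).norm_image_sub_le_of_norm_hasFDerivWithin_le
    (fun z _ => (hder z).hasFDerivWithinAt) hbound (left_mem_segment ℝ y x)
    (right_mem_segment ℝ y x)
  have hux : u x = ℓ x := indicator_of_mem hx _
  have huy : u y = ℓ y := indicator_of_mem hy _
  rw [hux, Real.dist_eq] at hd1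
  rw [huy, Real.dist_eq] at hd2
  rw [Real.norm_eq_abs] at hfl
  rw [abs_le] at hd1 hd2 hfl ⊢
  constructor <;> linarith [hd1.1, hd1.2, hd2.1, hd2.2, hfl.1, hfl.2]

end Cosserat

/-! ### Vertex quadrature and the `L²` product on piecewise linear functions. -/

namespace Cosserat

variable {d : ℕ}

/-- `α δ_ij + β` are the normalized second moments of barycentric coordinates of `d`-simplices. -/
structure IsMoments (d : ℕ) (α β : ℝ) : Prop where
  pos : 0 < α
  nonneg : 0 ≤ β
  total : α + (d + 1) * β = 1 / (d + 1)
  integral_eq : ∀ (b : AffineBasis (Fin (d + 1)) ℝ (Pt d)) (i j : Fin (d + 1)),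
    ∫ x in b.hull, b.coord i x * b.coord j x =
      volume.real b.hull * ((if i = j then α else 0) + β)

theorem exists_isMoments (hd : 1 ≤ d) : ∃ α β : ℝ, IsMoments d α β := by
  have : Nontrivial (Fin (d + 1)) := Fin.nontrivial_iff_two_le.2 (by omega)
  obtain ⟨α, β, h1, h2, h3, h4⟩ := AffineBasis.exists_moments (ι := Fin (d + 1)) (E := Pt d)
    volume (by simp)
  exact ⟨α, β, h1, h2, by simpa using h3, h4⟩

namespace SimplicialMesh

variable {M : SimplicialMesh d} {F : Type*} [NormedAddCommGroup F] [InnerProductSpace ℝ F]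

theorem Elem.volume_pos (T : M.Elem) : 0 < volume.real T.cell :=
  ENNReal.toReal_pos ((isOpen_interior.measure_pos volume T.interior_nonempty).trans_le
    (measure_mono interior_subset)).ne' T.isCompact.measure_lt_top.ne

theorem Elem.convex_cell (T : M.Elem) : Convex ℝ T.cell := convex_convexHull ℝ _

theorem Elem.interior_ae_eq (T : M.Elem) : (interior T.cell : Set (Pt d)) =ᵐ[volume] T.cell :=
  interior_ae_eq_of_null_frontier (T.convex_cell.addHaar_frontier volume)

theorem Elem.integrableOn (T : M.Elem) {G : Type*} [NormedAddCommGroup G] {f : Pt d → G}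
    (hf : Continuous f) : IntegrableOn f (interior T.cell) :=
  (hf.continuousOn.integrableOn_compact T.isCompact).mono_set interior_subset

/-- The vertices of an element as an affine basis. -/
theorem Elem.exists_basis (T : M.Elem) : ∃ b : AffineBasis (Fin (d + 1)) ℝ (Pt d),
    b.hull = T.cell ∧ ∃ e : Fin (d + 1) ≃ T.nodes, ∀ i, b i = e i := by
  let b₀ : AffineBasis T.nodes ℝ (Pt d) :=
    ⟨(↑), T.affineIndependent, by simpa using T.affineSpan_eq_top⟩
  let e := T.nodes.equivFinOfCardEq T.2.2
  refine ⟨b₀.reindex e, ?_, e.symm, fun i => rfl⟩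
  rw [AffineBasis.hull, AffineBasis.coe_reindex, EquivLike.range_comp, Elem.cell]
  congr 1
  exact Subtype.range_coe

theorem integral_inner_elem [FiniteDimensional ℝ F] {α β : ℝ} (h : IsMoments d α β) (T : M.Elem)
    (a c : Pt d →ᵃ[ℝ] F) :
    ∫ x in interior T.cell, ⟪a x, c x⟫ = volume.real T.cell *
      (α * ∑ x ∈ T.nodes, ⟪a x, c x⟫ + β * ⟪∑ x ∈ T.nodes, a x, ∑ x ∈ T.nodes, c x⟫) := by
  obtain ⟨b, hb, e, he⟩ := T.exists_basis
  have hs : ∀ {H : Type _} [AddCommMonoid H] (f : Pt d → H),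
      ∑ i, f (b i) = ∑ x ∈ T.nodes, f x := fun f => by
    rw [← Finset.sum_coe_sort T.nodes]
    exact Fintype.sum_equiv e _ _ fun i => by rw [he]
  have hs' : ∑ i, ⟪a (b i), c (b i)⟫ = ∑ x ∈ T.nodes, ⟪a x, c x⟫ := by
    rw [← Finset.sum_coe_sort T.nodes]
    exact Fintype.sum_equiv e _ _ fun i => by rw [he]
  rw [setIntegral_congr_set T.interior_ae_eq, ← hb, b.integral_inner_eq volume (h.integral_eq b),
    hs', hs a, hs c]

theorem space_eq_iUnion (M : SimplicialMesh d) : M.complex.space = ⋃ T : M.Elem, T.cell := by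
  ext x
  rw [Geometry.SimplicialComplex.mem_space_iff, mem_iUnion]
  constructor
  · rintro ⟨s, hs, hx⟩
    obtain ⟨t, ht, hst, hc⟩ := M.pure s hs
    exact ⟨⟨t, ht, hc⟩, convexHull_mono (Finset.coe_subset.2 hst) hx⟩
  · rintro ⟨T, hx⟩
    exact ⟨T.1, T.2.1, hx⟩

/-- Frontiers of convex sets are null, so only the open elements matter for integration. -/
theorem domain_ae_eq (M : SimplicialMesh d) :
    (M.domain : Set (Pt d)) =ᵐ[volume] ⋃ T : M.Elem, interior T.cell := by
  refine Filter.EventuallyLE.antisymm ?_ ?_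
  · have h1 : ∀ᵐ x ∂(volume : Measure (Pt d)), ∀ T : M.Elem, x ∈ T.cell → x ∈ interior T.cell :=
      ae_all_iff.2 fun T => T.interior_ae_eq.symm.le
    filter_upwards [h1] with x hx hxd
    have h2 : x ∈ M.complex.space := interior_subset hxd
    rw [space_eq_iUnion] at h2
    obtain ⟨T, hT⟩ := mem_iUnion.1 h2
    exact mem_iUnion.2 ⟨T, hx T hT⟩
  · exact LE.le.eventuallyLE (iUnion_subset fun T => T.interior_subset_domain)

theorem integral_domain {f : Pt d → ℝ} (hf : IntegrableOn f M.domain) :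
    ∫ x in M.domain, f x = ∑ T : M.Elem, ∫ x in interior T.cell, f x := by
  rw [setIntegral_congr_set M.domain_ae_eq]
  refine integral_iUnion_fintype (fun T => isOpen_interior.measurableSet) ?_ fun T =>
    hf.mono_set T.interior_subset_domain
  intro S T hST
  exact disjoint_left.2 fun x hS hT => hST (Elem.eq_of_mem_interior hS hT)

theorem inner_toL2 [FiniteDimensional ℝ F] (g : L2 M.domain F) (r : M.P1 F) :
    ⟪g, P1.toL2 M F r⟫ = ∑ T : M.Elem, ∫ x in interior T.cell, ⟪g x, r T x⟫ := by
  have hr : (P1.toL2 M F r : Pt d → F) =ᵐ[volume.restrict M.domain] r.toFun :=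
    MemLp.coeFn_toLp (P1.memLp r)
  rw [L2.inner_def, integral_domain (L2.integrable_inner (𝕜 := ℝ) g _)]
  refine Finset.sum_congr rfl fun T _ => integral_congr_ae ?_
  filter_upwards [ae_restrict_of_ae_restrict_of_subset T.interior_subset_domain hr,
    ae_restrict_mem isOpen_interior.measurableSet] with x hx hxT
  rw [hx, P1.toFun_of_mem r hxT]

variable [FiniteDimensional ℝ F]

theorem l2Form_apply' (a c : M.P1 F) :
    l2Form M F a c = ∑ T : M.Elem, ∫ x in interior T.cell, ⟪a T x, c T x⟫ := by
  have e : l2Form M F a c = ⟪P1.toL2 M F a, P1.toL2 M F c⟫ := rfl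
  have hr : (P1.toL2 M F a : Pt d → F) =ᵐ[volume.restrict M.domain] a.toFun :=
    MemLp.coeFn_toLp (P1.memLp a)
  rw [e, inner_toL2]
  refine Finset.sum_congr rfl fun T _ => integral_congr_ae ?_
  filter_upwards [ae_restrict_of_ae_restrict_of_subset T.interior_subset_domain hr,
    ae_restrict_mem isOpen_interior.measurableSet] with x hx hxT
  rw [hx, P1.toFun_of_mem a hxT]

theorem l2Form_self (a : M.P1 F) : l2Form M F a a = ‖P1.toL2 M F a‖ ^ 2 :=
  real_inner_self_eq_norm_sq (P1.toL2 M F a)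

theorem l2Form_proj1 (g : L2 M.domain F) (r : M.P1 F) :
    l2Form M F (proj1 g) r = ⟪g, P1.toL2 M F r⟫ :=
  projOn_spec (l2Form M F) l2Form_definite ⊤ (pairing g) Submodule.mem_top

variable {α β : ℝ}

theorem l2Form_eq (h : IsMoments d α β) (a c : M.P1 F) :
    l2Form M F a c = ∑ T : M.Elem, volume.real T.cell *
      (α * ∑ x ∈ T.nodes, ⟪a T x, c T x⟫ +
        β * ⟪∑ x ∈ T.nodes, a T x, ∑ x ∈ T.nodes, c T x⟫) := by
  rw [l2Form_apply']
  exact Finset.sum_congr rfl fun T _ => integral_inner_elem h T _ _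

theorem norm_sum_nodes_sq_le (T : M.Elem) (f : Pt d → F) :
    ‖∑ x ∈ T.nodes, f x‖ ^ 2 ≤ (d + 1) * ∑ x ∈ T.nodes, ‖f x‖ ^ 2 := by
  have h1 : ‖∑ x ∈ T.nodes, f x‖ ^ 2 ≤ (∑ x ∈ T.nodes, ‖f x‖) ^ 2 := by
    gcongr
    exact norm_sum_le _ _
  have h2 := sq_sum_le_card_mul_sum_sq (s := T.nodes) (f := fun x => ‖f x‖)
  have h3 : T.nodes.card = d + 1 := T.2.2
  rw [h3] at h2
  push_cast at h2
  exact h1.trans h2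

/-- Cauchy–Schwarz on the vertex sum turns the `β` term into `(d + 1) β` times the sum of squares,
and `α + (d + 1) β` is exactly the quadrature weight. -/
theorem l2Form_self_le_q1Form (h : IsMoments d α β) (a : M.P1 F) :
    l2Form M F a a ≤ q1Form M F a a := by
  rw [l2Form_eq h, q1Form_apply]
  refine Finset.sum_le_sum fun T _ => ?_
  rw [div_mul_eq_mul_div, mul_div_assoc]
  refine mul_le_mul_of_nonneg_left ?_ T.volume_pos.le
  simp only [real_inner_self_eq_norm_sq]
  have h1 := mul_le_mul_of_nonneg_left (norm_sum_nodes_sq_le T (a T)) h.nonneg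
  have h2 : (∑ x ∈ T.nodes, ‖a T x‖ ^ 2) / (d + 1) =
      (α + (d + 1) * β) * ∑ x ∈ T.nodes, ‖a T x‖ ^ 2 := by
    rw [h.total]; ring
  rw [h2]
  linarith

/-- The `β` term is nonnegative and is dropped; the `α` term alone is `(d + 1) α` times the
quadrature. -/
theorem q1Form_self_le_l2Form (h : IsMoments d α β) (a : M.P1 F) :
    (d + 1) * α * q1Form M F a a ≤ l2Form M F a a := by
  rw [l2Form_eq h, q1Form_apply, Finset.mul_sum]
  refine Finset.sum_le_sum fun T _ => ?_
  have h0 : ((d : ℝ) + 1) ≠ 0 := by positivity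
  have e : (d + 1) * α * (volume.real T.cell / (d + 1) * ∑ x ∈ T.nodes, ⟪a T x, a T x⟫) =
      volume.real T.cell * (α * ∑ x ∈ T.nodes, ⟪a T x, a T x⟫) := by
    field_simp
  rw [e]
  refine mul_le_mul_of_nonneg_left ?_ T.volume_pos.le
  have := mul_nonneg h.nonneg (real_inner_self_nonneg (x := ∑ x ∈ T.nodes, a T x))
  linarith

/-- The difference of a piecewise linear function and its elementwise mean. -/
noncomputable def P1.meanFree (r : M.P1 F) : M.P1 F := fun T =>
  r T - AffineMap.const ℝ (Pt d) ((d + 1 : ℝ)⁻¹ • ∑ x ∈ T.nodes, r T x)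

theorem P1.meanFree_apply (r : M.P1 F) (T : M.Elem) (x : Pt d) :
    r.meanFree T x = r T x - (d + 1 : ℝ)⁻¹ • ∑ x ∈ T.nodes, r T x := rfl

theorem P1.sum_meanFree (r : M.P1 F) (T : M.Elem) : ∑ x ∈ T.nodes, r.meanFree T x = 0 := by
  have h0 : ((d : ℝ) + 1) ≠ 0 := by positivity
  have h3 : T.nodes.card = d + 1 := T.2.2
  simp only [P1.meanFree_apply, Finset.sum_sub_distrib, Finset.sum_const, h3]
  rw [← Nat.cast_smul_eq_nsmul ℝ, smul_smul]
  push_cast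
  rw [mul_inv_cancel₀ h0, one_smul, sub_self]

theorem sum_inner_meanFree (a r : M.P1 F) (T : M.Elem) :
    ∑ x ∈ T.nodes, ⟪a T x, r.meanFree T x⟫ = ∑ x ∈ T.nodes, ⟪a T x, r T x⟫ -
      (d + 1 : ℝ)⁻¹ * ⟪∑ x ∈ T.nodes, a T x, ∑ x ∈ T.nodes, r T x⟫ := by
  simp only [P1.meanFree_apply, inner_sub_right, Finset.sum_sub_distrib, real_inner_smul_right]
  rw [← Finset.mul_sum, sum_inner]

/-- The vertex quadrature differs from the `L²` inner product by a multiple of the `L²` product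
with the mean-free part. -/
theorem q1Form_eq (h : IsMoments d α β) (a r : M.P1 F) :
    q1Form M F a r = l2Form M F a r + β * (d + 1) / α * l2Form M F a r.meanFree := by
  have h0 : ((d : ℝ) + 1) ≠ 0 := by positivity
  have hα := h.pos.ne'
  rw [l2Form_eq h, l2Form_eq h, q1Form_apply, Finset.mul_sum, ← Finset.sum_add_distrib]
  refine Finset.sum_congr rfl fun T _ => ?_
  rw [P1.sum_meanFree, sum_inner_meanFree, inner_zero_right, mul_zero, add_zero]
  set S := ∑ x ∈ T.nodes, ⟪a T x, r T x⟫
  set P := ⟪∑ x ∈ T.nodes, a T x, ∑ x ∈ T.nodes, r T x⟫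
  have h1 : volume.real T.cell / (d + 1) * S = volume.real T.cell * ((1 / (d + 1)) * S) := by ring
  rw [h1, ← h.total]
  field_simp
  ring

/-- Subtracting the elementwise mean is an orthogonal projection, hence a contraction. In vertex
values, this only removes nonnegative multiples of the squared vertex sum. -/
theorem l2Form_meanFree_le (h : IsMoments d α β) (r : M.P1 F) :
    l2Form M F r.meanFree r.meanFree ≤ l2Form M F r r := by
  rw [l2Form_eq h, l2Form_eq h]
  refine Finset.sum_le_sum fun T _ => mul_le_mul_of_nonneg_left ?_ T.volume_pos.le
  have e : ∑ x ∈ T.nodes, ⟪r.meanFree T x, r.meanFree T x⟫ =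
      ∑ x ∈ T.nodes, ⟪r T x, r T x⟫ -
        (d + 1 : ℝ)⁻¹ * ⟪∑ x ∈ T.nodes, r T x, ∑ x ∈ T.nodes, r T x⟫ := by
    rw [sum_inner_meanFree r.meanFree r T, P1.sum_meanFree, inner_zero_left, mul_zero, sub_zero,
      ← sum_inner_meanFree]
    exact Finset.sum_congr rfl fun x _ => real_inner_comm _ _
  rw [e, P1.sum_meanFree, inner_zero_right, mul_zero, add_zero]
  have h1 : 0 ≤ ⟪∑ x ∈ T.nodes, r T x, ∑ x ∈ T.nodes, r T x⟫ := real_inner_self_nonneg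
  have h2 := mul_nonneg h.nonneg h1
  have h3 : 0 ≤ α * ((d + 1 : ℝ)⁻¹ * ⟪∑ x ∈ T.nodes, r T x, ∑ x ∈ T.nodes, r T x⟫) :=
    mul_nonneg h.pos.le (mul_nonneg (by positivity) h1)
  rw [mul_sub]
  linarith

end SimplicialMesh

end Cosserat

/-! ### The divergence of `ℓ` times an affine field, and the estimate on one element. -/

namespace Cosserat

variable {d : ℕ}

/-- The (constant) divergence of an affine vector field. -/
noncomputable def affineDiv (a : Pt d →ᵃ[ℝ] Pt d) : ℝ :=
  ∑ i, a.linear (EuclideanSpace.single i 1) i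

theorem hasFDerivAt_affineMap {F : Type*} [NormedAddCommGroup F] [NormedSpace ℝ F]
    (a : Pt d →ᵃ[ℝ] F) (x : Pt d) :
    HasFDerivAt a (LinearMap.toContinuousLinearMap a.linear) x := by
  have h1 : HasFDerivAt (fun x => LinearMap.toContinuousLinearMap a.linear x + a 0)
      (LinearMap.toContinuousLinearMap a.linear) x :=
    (ContinuousLinearMap.hasFDerivAt _).add_const _
  have h2 : (a : Pt d → F) = fun x => LinearMap.toContinuousLinearMap a.linear x + a 0 := a.decomp
  rw [h2]
  exact h1

theorem contDiff_affineMap {F : Type*} [NormedAddCommGroup F] [NormedSpace ℝ F]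
    (a : Pt d →ᵃ[ℝ] F) : ContDiff ℝ (⊤ : ℕ∞) a := by
  have h2 : (a : Pt d → F) = fun x => LinearMap.toContinuousLinearMap a.linear x + a 0 := a.decomp
  rw [h2]
  exact (ContinuousLinearMap.contDiff _).add contDiff_const

/-- The product rule for the weak divergence of a weakly differentiable function times an affine
vector field. -/
theorem HasWeakDiv.ae_eq_of_smul_affine {U : Set (Pt d)} (hU : IsOpen U)
    (hb : Bornology.IsBounded U) {ℓ : Pt d → ℝ} (hint : IntegrableOn ℓ U) {G : Pt d → Pt d}
    (hGint : IntegrableOn G U) (hG : ∀ i, HasWeakPartial U i ℓ (fun x => G x i))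
    (a : Pt d →ᵃ[ℝ] Pt d) {g : Pt d → ℝ} (hgint : IntegrableOn g U)
    (hg : HasWeakDiv U (fun x => ℓ x • a x) g) :
    ∀ᵐ x ∂(volume.restrict U), g x = ⟪G x, a x⟫ + ℓ x * affineDiv a := by
  have hac : Continuous a := (contDiff_affineMap a).continuous
  have hGa : IntegrableOn (fun x => ⟪G x, a x⟫) U := by
    obtain ⟨C, hC⟩ := hb.isCompact_closure.exists_bound_of_continuousOn hac.continuousOn
    refine (hGint.norm.const_mul C).mono' (hGint.1.inner hac.aestronglyMeasurable) ?_
    filter_upwards [ae_restrict_mem hU.measurableSet] with x hx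
    refine (norm_inner_le_norm _ _).trans ?_
    rw [mul_comm]
    exact mul_le_mul_of_nonneg_right (hC x (subset_closure hx)) (norm_nonneg _)
  have hR : IntegrableOn (fun x => ⟪G x, a x⟫ + ℓ x * affineDiv a) U :=
    hGa.add (hint.mul_const _)
  have key := hU.ae_eq_zero_of_integral_contDiff_smul_eq_zero (μ := volume)
    (f := fun x => g x - (⟪G x, a x⟫ + ℓ x * affineDiv a)) (hgint.sub hR).locallyIntegrableOn ?_
  · rw [ae_restrict_iff' hU.measurableSet]
    filter_upwards [key] with x hx hxU
    exact sub_eq_zero.1 (hx hxU)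
  intro φ hφ hc hsup
  have hmul : ∀ {f ψ : Pt d → ℝ}, IntegrableOn f U → Continuous ψ → HasCompactSupport ψ →
      IntegrableOn (fun x => f x * ψ x) U := by
    intro f ψ hf hψ hψs
    obtain ⟨C, hC⟩ := hψ.bounded_above_of_compact_support hψs
    exact Integrable.mul_bdd hf hψ.aestronglyMeasurable (Filter.Eventually.of_forall hC)
  have e0 : ∫ x, φ x • (g x - (⟪G x, a x⟫ + ℓ x * affineDiv a)) =
      ∫ x in U, (g x * φ x - (⟪G x, a x⟫ + ℓ x * affineDiv a) * φ x) := by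
    rw [setIntegral_eq_integral_of_forall_compl_eq_zero]
    · congr 1
      ext x
      rw [smul_eq_mul]
      ring
    · intro x hx
      rw [image_eq_zero_of_notMem_tsupport fun h => hx (hsup h)]
      ring
  rw [e0, integral_sub (hmul hgint hφ.continuous hc) (hmul hR hφ.continuous hc)]
  have hai : ∀ i, ContDiff ℝ (⊤ : ℕ∞) fun x => a x i := fun i =>
    (EuclideanSpace.proj (𝕜 := ℝ) i).contDiff.comp (contDiff_affineMap a)
  -- As `a` is smooth, `φ a_i` is a test function for `∂_i ℓ`. Summing over `i` produces `∇φ·a + φ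
  -- ∇·a`, whose first term is the one tested in the weak divergence.
  have hχ : ∀ i, IsTest fun x => φ x * a x i := fun i =>
    ⟨hφ.mul (hai i), hc.mul_right⟩
  have hχs : ∀ i, tsupport (fun x => φ x * a x i) ⊆ U := fun i =>
    (tsupport_mul_subset_left).trans hsup
  have hχd : ∀ i x, fderiv ℝ (fun x => φ x * a x i) x (EuclideanSpace.single i 1) =
      φ x * a.linear (EuclideanSpace.single i 1) i +
        a x i * fderiv ℝ φ x (EuclideanSpace.single i 1) := by
    intro i x
    have h1 : HasFDerivAt (fun x => a x i) ((EuclideanSpace.proj (𝕜 := ℝ) i).comp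
        (LinearMap.toContinuousLinearMap a.linear)) x :=
      (EuclideanSpace.proj (𝕜 := ℝ) i).hasFDerivAt.comp x (hasFDerivAt_affineMap a x)
    have h2 : HasFDerivAt φ (fderiv ℝ φ x) x :=
      (hφ.differentiable (by simp)).differentiableAt.hasFDerivAt
    have h3 : fderiv ℝ (fun x => φ x * a x i) x = _ := (h2.mul h1).fderiv
    rw [h3]
    simp
  have hsum : ∀ x, ∑ i, ℓ x * fderiv ℝ (fun x => φ x * a x i) x (EuclideanSpace.single i 1) =
      fderiv ℝ φ x (ℓ x • a x) + ℓ x * affineDiv a * φ x := by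
    intro x
    have h1 : fderiv ℝ φ x (ℓ x • a x) =
        ∑ i, ℓ x * (a x i * fderiv ℝ φ x (EuclideanSpace.single i 1)) := by
      rw [map_smul]
      conv_lhs => rw [eq_sum_single (a x)]
      rw [map_sum, smul_eq_mul, Finset.mul_sum]
      simp
    rw [h1, affineDiv, Finset.mul_sum, Finset.sum_mul, ← Finset.sum_add_distrib]
    refine Finset.sum_congr rfl fun i _ => ?_
    rw [hχd]
    ring
  have hli : ∀ i, IntegrableOn (fun x => ℓ x * fderiv ℝ (fun x => φ x * a x i) x
      (EuclideanSpace.single i 1)) U := fun i =>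
    hmul hint (((hχ i).1.continuous_fderiv (by simp)).clm_apply continuous_const)
      ((hχ i).2.fderiv_apply ℝ _)
  have hlφ : IntegrableOn (fun x => ℓ x * affineDiv a * φ x) U :=
    hmul (hint.mul_const _) hφ.continuous hc
  have hGφ : IntegrableOn (fun x => ⟪G x, a x⟫ * φ x) U := hmul hGa hφ.continuous hc
  have hGi : ∀ i, IntegrableOn (fun x => G x i * (φ x * a x i)) U := fun i =>
    hmul ((EuclideanSpace.proj (𝕜 := ℝ) i).integrable_comp hGint) (hχ i).1.continuous (hχ i).2
  have h3 : ∫ x in U, ∑ i, ℓ x * fderiv ℝ (fun x => φ x * a x i) x (EuclideanSpace.single i 1) =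
      - ∫ x in U, ⟪G x, a x⟫ * φ x := by
    rw [integral_finsetSum _ fun i _ => hli i,
      Finset.sum_congr rfl fun i _ => hG i _ (hχ i) (hχs i), Finset.sum_neg_distrib,
      ← integral_finsetSum _ fun i _ => hGi i]
    congr 2
    ext x
    rw [PiLp.inner_apply, Finset.sum_mul]
    refine Finset.sum_congr rfl fun i _ => ?_
    simp
    ring
  have h4 := hg φ ⟨hφ, hc⟩ hsup
  have hdφ : IntegrableOn (fun x => fderiv ℝ φ x (ℓ x • a x)) U := by
    have : (fun x => fderiv ℝ φ x (ℓ x • a x)) = fun x =>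
        ∑ i, ℓ x * fderiv ℝ (fun x => φ x * a x i) x (EuclideanSpace.single i 1) -
          ℓ x * affineDiv a * φ x := by
      ext x
      rw [hsum]
      ring
    rw [this]
    exact (integrable_finsetSum _ fun i _ => hli i).sub hlφ
  simp only [hsum] at h3
  rw [integral_add hdφ hlφ] at h3
  have h5 : ∫ x in U, (⟪G x, a x⟫ + ℓ x * affineDiv a) * φ x =
      (∫ x in U, ⟪G x, a x⟫ * φ x) + ∫ x in U, ℓ x * affineDiv a * φ x := by
    rw [← integral_add hGφ hlφ]
    simp only [add_mul]
  rw [h5]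
  linarith

/-- An inverse inequality: the divergence of an affine field in terms of its size. -/
theorem abs_affineDiv_le (a : Pt d →ᵃ[ℝ] Pt d) {c : Pt d} {ρ B : ℝ} (hρ : 0 < ρ)
    (hB : ∀ x ∈ Metric.ball c ρ, ‖a x‖ ≤ B) : |affineDiv a| * ρ ≤ 4 * d * B := by
  have h1 : ∀ i : Fin d, |a.linear (EuclideanSpace.single i 1) i| * ρ ≤ 4 * B := by
    intro i
    set e : Pt d := EuclideanSpace.single i 1 with he
    -- The step `ρ / 2` stays inside the open ball. The difference quotient then gives `(ρ / 2) |∂_i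
    -- a_i| ≤ 2 B`, whence the factor `4`.
    have hn : ‖(ρ / 2) • e‖ = ρ / 2 := by
      rw [norm_smul, he, PiLp.norm_single, norm_one, mul_one,
        Real.norm_of_nonneg (by positivity)]
    have h2 := a.linearMap_vsub (c + (ρ / 2) • e) c
    rw [vsub_eq_sub, vsub_eq_sub, add_sub_cancel_left, map_smul] at h2
    have h3 : ‖a (c + (ρ / 2) • e) - a c‖ ≤ B + B := by
      refine (norm_sub_le _ _).trans (add_le_add (hB _ ?_) (hB _ (Metric.mem_ball_self hρ)))
      rw [Metric.mem_ball, dist_eq_norm, add_sub_cancel_left, hn]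
      linarith
    rw [← h2, norm_smul, Real.norm_of_nonneg (by positivity)] at h3
    have h4 : |a.linear e i| ≤ ‖a.linear e‖ := PiLp.norm_apply_le (a.linear e) i
    nlinarith
  calc |affineDiv a| * ρ ≤ (∑ i, |a.linear (EuclideanSpace.single i 1) i|) * ρ :=
        mul_le_mul_of_nonneg_right (Finset.abs_sum_le_sum_abs _ _) hρ.le
    _ = ∑ i, |a.linear (EuclideanSpace.single i 1) i| * ρ := Finset.sum_mul _ _ _
    _ ≤ ∑ _i : Fin d, 4 * B := Finset.sum_le_sum fun i _ => h1 i
    _ = 4 * d * B := by simp; ring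

namespace SimplicialMesh

variable {M : SimplicialMesh d}

theorem norm_le_of_mem_cell {F : Type*} [NormedAddCommGroup F] [NormedSpace ℝ F] (T : M.Elem)
    (a : Pt d →ᵃ[ℝ] F) {B : ℝ} (hB : ∀ x ∈ T.nodes, ‖a x‖ ≤ B) {x : Pt d} (hx : x ∈ T.cell) :
    ‖a x‖ ≤ B := by
  have h1 : T.cell ⊆ a ⁻¹' Metric.closedBall 0 B :=
    convexHull_min (fun y hy => by simpa using hB y hy)
      ((convex_closedBall (0 : F) B).affine_preimage a)
  simpa using h1 hx

/-- In the moment formula against the constant field `e_k`, both terms contain the vertex sum of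
`s`. -/
theorem integral_apply_eq_zero {α β : ℝ} (h : IsMoments d α β) {m : ℕ} (T : M.Elem)
    (s : Pt d →ᵃ[ℝ] EuclideanSpace ℝ (Fin m)) (hs : ∑ x ∈ T.nodes, s x = 0) (k : Fin m) :
    ∫ x in interior T.cell, s x k = 0 := by
  have h1 := integral_inner_elem h T s (AffineMap.const ℝ _ (EuclideanSpace.single k 1))
  simp only [AffineMap.const_apply, hs, inner_zero_left, mul_zero, add_zero] at h1
  rw [← sum_inner, hs, inner_zero_left, mul_zero, mul_zero] at h1
  rw [← h1]
  congr 1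
  ext x
  simp [EuclideanSpace.inner_single_right]

/-- Cancellation against mean-free `s` removes the part `ℓ(x₀) ∇·a_k` of the divergence; what
remains is pointwise of the size of `a_k`. The free parameter `t` of Young's inequality is kept so
that bounds can be summed over elements and absorbed later. -/
theorem local_bound {α β : ℝ} (hαβ : IsMoments d α β) {m : ℕ} (T : M.Elem) {γ L ρ : ℝ}
    {c : Pt d} (hρ : 0 < ρ) (hball : Metric.ball c ρ ⊆ T.cell)
    (hdiam : Metric.diam T.cell ≤ γ * ρ) {ℓ : Pt d → ℝ} {G : Pt d → Pt d} (hL : 0 ≤ L)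
    (hℓ : ∀ x ∈ interior T.cell, ∀ y ∈ interior T.cell, |ℓ x - ℓ y| ≤ L * ‖x - y‖)
    (hG : ∀ᵐ x ∂(volume.restrict (interior T.cell)), ‖G x‖ ≤ L)
    (a : Fin m → (Pt d →ᵃ[ℝ] Pt d)) {B : Fin m → ℝ} (hB : ∀ k, ∀ x ∈ T.nodes, ‖a k x‖ ≤ B k)
    {g : Pt d → EuclideanSpace ℝ (Fin m)} (hgint : IntegrableOn g (interior T.cell))
    (hg : ∀ k, ∀ᵐ x ∂(volume.restrict (interior T.cell)),
      g x k = ⟪G x, a k x⟫ + ℓ x * affineDiv (a k))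
    (s : Pt d →ᵃ[ℝ] EuclideanSpace ℝ (Fin m)) (hs : ∑ x ∈ T.nodes, s x = 0) {t : ℝ} (ht : 0 < t) :
    |∫ x in interior T.cell, ⟪g x, s x⟫| ≤
      (1 / 2) * (t * ((L * (1 + 4 * d * γ)) ^ 2 * (volume.real T.cell * ∑ k, B k ^ 2)) +
        t⁻¹ * ∫ x in interior T.cell, ⟪s x, s x⟫) := by
  set K := L * (1 + 4 * d * γ) with hK
  obtain ⟨x₀, hx₀⟩ := T.interior_nonempty
  have hm : MeasurableSet (interior T.cell) := isOpen_interior.measurableSet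
  have hsc : Continuous s := (contDiff_affineMap s).continuous
  have hsk : ∀ k, Continuous fun x => s x k := fun k =>
    (EuclideanSpace.proj (𝕜 := ℝ) k).continuous.comp hsc
  have hgs : IntegrableOn (fun x => ⟪g x, s x⟫) (interior T.cell) := by
    obtain ⟨C, hC⟩ := T.isCompact.exists_bound_of_continuousOn hsc.continuousOn
    refine (hgint.norm.const_mul C).mono' (hgint.1.inner hsc.aestronglyMeasurable) ?_
    filter_upwards [ae_restrict_mem hm] with x hx
    refine (norm_inner_le_norm _ _).trans ?_
    rw [mul_comm]
    exact mul_le_mul_of_nonneg_right (hC x (interior_subset hx)) (norm_nonneg _)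
  have hci : ∀ k, IntegrableOn (fun x => ℓ x₀ * affineDiv (a k) * s x k) (interior T.cell) :=
    fun k => (T.integrableOn (hsk k)).const_mul _
  -- The subtracted terms are constants times components of `s`, so they integrate to zero; any
  -- interior point `x₀` serves.
  have e1 : ∫ x in interior T.cell, ⟪g x, s x⟫ =
      ∫ x in interior T.cell, (⟪g x, s x⟫ - ∑ k, ℓ x₀ * affineDiv (a k) * s x k) := by
    rw [integral_sub hgs (integrable_finsetSum _ fun k _ => hci k),
      integral_finsetSum _ fun k _ => hci k]
    simp only [integral_const_mul, integral_apply_eq_zero hαβ T s hs, mul_zero,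
      Finset.sum_const_zero, sub_zero]
  have hss : IntegrableOn (fun x => ⟪s x, s x⟫) (interior T.cell) :=
    T.integrableOn (hsc.inner hsc)
  have hvol : volume.real (interior T.cell) = volume.real T.cell :=
    measureReal_congr T.interior_ae_eq
  have hcst : ∀ C : ℝ, IntegrableOn (fun _ => C) (interior T.cell) := fun C =>
    T.integrableOn continuous_const
  have e2 : ∫ x in interior T.cell, (1 / 2) * (t * (K ^ 2 * ∑ k, B k ^ 2) + t⁻¹ * ⟪s x, s x⟫) =
      (1 / 2) * (t * (K ^ 2 * (volume.real T.cell * ∑ k, B k ^ 2)) +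
        t⁻¹ * ∫ x in interior T.cell, ⟪s x, s x⟫) := by
    rw [integral_const_mul, integral_add (hcst _) (hss.const_mul _),
      integral_const_mul t⁻¹, setIntegral_const, hvol, smul_eq_mul]
    ring
  rw [e1, ← e2, ← Real.norm_eq_abs]
  refine norm_integral_le_of_norm_le
    (((hcst _).add (hss.const_mul _)).const_mul _) ?_
  filter_upwards [hG, ae_all_iff.2 hg, ae_restrict_mem hm] with x hGx hgx hx
  have e3 : ⟪g x, s x⟫ - ∑ k, ℓ x₀ * affineDiv (a k) * s x k =
      ∑ k, (⟪G x, a k x⟫ + (ℓ x - ℓ x₀) * affineDiv (a k)) * s x k := by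
    rw [PiLp.inner_apply, ← Finset.sum_sub_distrib]
    refine Finset.sum_congr rfl fun k _ => ?_
    simp only [RCLike.inner_apply, conj_trivial, hgx]
    ring
  have hdist : ‖x - x₀‖ ≤ γ * ρ := by
    rw [← dist_eq_norm]
    exact (Metric.dist_le_diam_of_mem T.isCompact.isBounded (interior_subset hx)
      (interior_subset hx₀)).trans hdiam
  -- The factor `γ ρ` from the oscillation of `ℓ` cancels the `1/ρ` of the inverse inequality,
  -- leaving no mesh size.
  have hE : ∀ k, |⟪G x, a k x⟫ + (ℓ x - ℓ x₀) * affineDiv (a k)| ≤ K * B k := by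
    intro k
    have hak : ‖a k x‖ ≤ B k := norm_le_of_mem_cell T (a k) (hB k) (interior_subset hx)
    have h1 : |⟪G x, a k x⟫| ≤ L * B k :=
      (abs_real_inner_le_norm _ _).trans (mul_le_mul hGx hak (norm_nonneg _) hL)
    have h2 := abs_affineDiv_le (a k) hρ fun y hy =>
      norm_le_of_mem_cell T (a k) (hB k) (hball hy)
    have hγ : 0 ≤ γ := by
      have := Metric.diam_nonneg.trans hdiam
      exact nonneg_of_mul_nonneg_left this hρ
    have h3 : |(ℓ x - ℓ x₀) * affineDiv (a k)| ≤ L * γ * (4 * d * B k) := by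
      rw [abs_mul]
      calc |ℓ x - ℓ x₀| * |affineDiv (a k)| ≤ (L * (γ * ρ)) * |affineDiv (a k)| :=
            mul_le_mul_of_nonneg_right ((hℓ x hx x₀ hx₀).trans
              (mul_le_mul_of_nonneg_left hdist hL)) (abs_nonneg _)
        _ = L * γ * (|affineDiv (a k)| * ρ) := by ring
        _ ≤ _ := mul_le_mul_of_nonneg_left h2 (mul_nonneg hL hγ)
    calc _ ≤ _ := abs_add_le _ _
      _ ≤ _ := add_le_add h1 h3
      _ = K * B k := by rw [hK]; ring
  rw [e3, Real.norm_eq_abs]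
  calc _ ≤ ∑ k, |(⟪G x, a k x⟫ + (ℓ x - ℓ x₀) * affineDiv (a k)) * s x k| :=
        Finset.abs_sum_le_sum_abs _ _
    _ ≤ ∑ k, (1 / 2) * (t * (K ^ 2 * B k ^ 2) + t⁻¹ * (s x k) ^ 2) := by
        refine Finset.sum_le_sum fun k _ => ?_
        rw [abs_mul]
        have h4 := mul_le_mul_of_nonneg_right (hE k) (abs_nonneg (s x k))
        -- Young's inequality with weight `t`, in the form of an expanded square.
        have h5 : 0 ≤ t⁻¹ * (t * (K * B k) - |s x k|) ^ 2 := by positivity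
        have h6 : t⁻¹ * (t * (K * B k) - |s x k|) ^ 2 =
            t * (K ^ 2 * B k ^ 2) - 2 * (K * B k * |s x k|) + t⁻¹ * (s x k) ^ 2 := by
          rw [← sq_abs (s x k)]
          field_simp
          ring
        linarith
    _ = _ := by
        rw [real_inner_self_eq_norm_sq, EuclideanSpace.norm_sq_eq, ← Finset.mul_sum,
          Finset.sum_add_distrib, ← Finset.mul_sum, ← Finset.mul_sum, ← Finset.mul_sum]
        simp only [Real.norm_eq_abs, sq_abs]

end SimplicialMesh

end Cosserat

/-! ### The global mean-free estimate and the comparison of the two projections. -/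

namespace Cosserat

namespace SimplicialMesh

variable {d : ℕ} {M : SimplicialMesh d} {α β : ℝ}

theorem Elem.isFiniteMeasure_restrict (T : M.Elem) :
    IsFiniteMeasure ((volume : Measure (Pt d)).restrict (interior T.cell)) :=
  ⟨by
    rw [Measure.restrict_apply_univ]
    exact (measure_mono interior_subset).trans_lt T.isCompact.measure_lt_top⟩

theorem Elem.integrableOn_of_memLp (T : M.Elem) {F : Type*} [NormedAddCommGroup F] {p : ℝ≥0∞}
    (hp : 1 ≤ p) {f : Pt d → F} (hf : MemLp f p (volume.restrict M.domain)) :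
    IntegrableOn f (interior T.cell) := by
  have := T.isFiniteMeasure_restrict
  exact (hf.mono_measure (Measure.restrict_mono T.interior_subset_domain le_rfl)).integrable hp

/-- The maximum with `0` reflects the truncation in `ENNReal.ofReal`. -/
theorem ae_norm_le_of_eLpNorm_le {F : Type*} [NormedAddCommGroup F] {μ : Measure (Pt d)}
    {f : Pt d → F} {L : ℝ} (h : eLpNorm f ∞ μ ≤ ENNReal.ofReal L) :
    ∀ᵐ x ∂μ, ‖f x‖ ≤ max L 0 := by
  rw [eLpNorm_exponent_top] at h
  filter_upwards [ae_le_eLpNormEssSup (f := f) (μ := μ)] with x hx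
  have h1 := ENNReal.toReal_mono ENNReal.ofReal_ne_top (hx.trans h)
  rwa [toReal_enorm, ENNReal.toReal_ofReal'] at h1

theorem normSq_eq {m : ℕ} {τ : TensorField d m} (hτ : ∀ k, MemLp (τ k) 2 (volume.restrict M.domain))
    {a : Fin m → M.P1 (Pt d)} (ha : ∀ k, τ k =ᵐ[volume.restrict M.domain] (a k).toFun) :
    normSq M.domain τ =
      ∑ T : M.Elem, ∑ k, ∫ x in interior T.cell, ⟪a k T x, a k T x⟫ := by
  rw [normSq, Finset.sum_comm]
  refine Finset.sum_congr rfl fun k _ => ?_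
  rw [integral_domain ((memLp_two_iff_integrable_sq_norm (hτ k).1).1 (hτ k))]
  refine Finset.sum_congr rfl fun T _ => integral_congr_ae ?_
  filter_upwards [ae_restrict_of_ae_restrict_of_subset T.interior_subset_domain (ha k),
    ae_restrict_mem isOpen_interior.measurableSet] with x hx hxT
  rw [hx, P1.toFun_of_mem _ hxT, real_inner_self_eq_norm_sq]

/-- Vertex values are controlled by the local `L²` norm once the nonnegative `β` term is dropped.
This replaces an inverse estimate from `L^∞` to `L²`. -/
theorem volume_mul_sum_nodes_le (h : IsMoments d α β) (T : M.Elem) (a : Pt d →ᵃ[ℝ] Pt d) :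
    volume.real T.cell * ∑ x ∈ T.nodes, ‖a x‖ ^ 2 ≤ α⁻¹ * ∫ x in interior T.cell, ⟪a x, a x⟫ := by
  rw [integral_inner_elem h, ← div_eq_inv_mul, le_div_iff₀ h.pos, mul_assoc]
  refine mul_le_mul_of_nonneg_left ?_ T.volume_pos.le
  have h1 := mul_nonneg h.nonneg (real_inner_self_nonneg (x := ∑ x ∈ T.nodes, a x))
  simp only [real_inner_self_eq_norm_sq] at h1 ⊢
  linarith

/-- The divergence of `ℓ ω` tests against elementwise mean-free piecewise linear functions like an
`L²` function controlled by `ω`. -/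
theorem abs_l2Form_proj1_weakDiv_le (h : IsMoments d α β) {γ L : ℝ} (hγ : M.ShapeRegular γ)
    {Γ : Set (Pt d)} {ℓ : Pt d → ℝ} (hℓ : IsLengthScale M.domain L ℓ)
    {ω : TensorField d (d.choose 2)} (hω : ω ∈ M.coupleStressFE Γ ℓ)
    (r : M.P1 (EuclideanSpace ℝ (Fin (d.choose 2)))) (hr : ∀ T, ∑ x ∈ T.nodes, r T x = 0)
    {t : ℝ} (ht : 0 < t) :
    |l2Form M _ (proj1 (weakDiv M.domain (scaled ℓ ω))) r| ≤
      (1 / 2) * (t * ((max L 0 * (1 + 4 * d * γ)) ^ 2 * (α⁻¹ * normSq M.domain ω)) +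
        t⁻¹ * l2Form M _ r r) := by
  obtain ⟨G, hGmem, hGw, hGb⟩ := hℓ.bound
  set g := weakDiv M.domain (scaled ℓ ω) with hg
  have hdom : IsOpen M.domain := isOpen_interior
  have hGL := ae_norm_le_of_eLpNorm_le (le_add_self.trans hGb)
  have hℓmem : MemLp ℓ ∞ (volume.restrict M.domain) :=
    ⟨hℓ.continuousOn.aestronglyMeasurable hdom.measurableSet,
      ((le_self_add.trans hGb).trans_lt ENNReal.ofReal_lt_top)⟩
  choose a ha using fun k => (hω.1 k).1
  rw [l2Form_proj1, inner_toL2, l2Form_apply', normSq_eq hω.2.1 ha]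
  have key : ∀ T : M.Elem, |∫ x in interior T.cell, ⟪g x, r T x⟫| ≤
      (1 / 2) * (t * ((max L 0 * (1 + 4 * d * γ)) ^ 2 *
        (α⁻¹ * ∑ k, ∫ x in interior T.cell, ⟪a k T x, a k T x⟫)) +
        t⁻¹ * ∫ x in interior T.cell, ⟪r T x, r T x⟫) := by
    intro T
    obtain ⟨c, ρ, hρ, hball, hdiam⟩ := hγ T
    have hTd := T.interior_subset_domain
    have hGT := ae_restrict_of_ae_restrict_of_subset hTd hGL
    have hGi : IntegrableOn G (interior T.cell) := T.integrableOn_of_memLp le_top hGmem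
    have hℓi : IntegrableOn ℓ (interior T.cell) := T.integrableOn_of_memLp le_top hℓmem
    have hgi : IntegrableOn g (interior T.cell) :=
      T.integrableOn_of_memLp one_le_two (Lp.memLp g)
    have hGw' := fun i => (hGw i).mono hTd
    have hlip : ∀ x ∈ interior T.cell, ∀ y ∈ interior T.cell,
        |ℓ x - ℓ y| ≤ max L 0 * ‖x - y‖ := fun x hx y hy =>
      abs_sub_le_of_hasWeakPartial isOpen_interior T.convex_cell.interior
        (hℓ.continuousOn.mono hTd) hℓi hGi hGw' hGT hx hy
    have hgk : ∀ k, ∀ᵐ x ∂(volume.restrict (interior T.cell)),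
        g x k = ⟪G x, a k T x⟫ + ℓ x * affineDiv (a k T) := by
      intro k
      refine HasWeakDiv.ae_eq_of_smul_affine isOpen_interior
        (T.isCompact.isBounded.subset interior_subset) hℓi hGi hGw' (a k T)
        ((EuclideanSpace.proj (𝕜 := ℝ) k).integrable_comp hgi) ?_
      intro φ hφ hsup
      rw [← (weakDiv_spec hω.2.2.1 k).mono hTd φ hφ hsup]
      refine integral_congr_ae ?_
      filter_upwards [ae_restrict_of_ae_restrict_of_subset hTd (ha k),
        ae_restrict_mem isOpen_interior.measurableSet] with x hx hxT
      rw [scaled, hx, P1.toFun_of_mem _ hxT]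
    -- The Euclidean norm of the vertex values, rather than their maximum, is chosen because its
    -- square is what `volume_mul_sum_nodes_le` bounds.
    have hB : ∀ k, ∀ x ∈ T.nodes, ‖a k T x‖ ≤ √(∑ x ∈ T.nodes, ‖a k T x‖ ^ 2) := by
      intro k x hx
      refine Real.le_sqrt_of_sq_le ?_
      exact Finset.single_le_sum (f := fun x => ‖a k T x‖ ^ 2) (fun y _ => by positivity) hx
    refine (local_bound h T hρ hball hdiam (le_max_right _ _) hlip hGT (fun k => a k T) hB hgi
      hgk (r T) (hr T) ht).trans ?_
    refine mul_le_mul_of_nonneg_left (add_le_add_left (mul_le_mul_of_nonneg_left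
      (mul_le_mul_of_nonneg_left ?_ (sq_nonneg _)) ht.le) _) (by norm_num)
    rw [Finset.mul_sum, Finset.mul_sum]
    refine Finset.sum_le_sum fun k _ => ?_
    rw [Real.sq_sqrt (Finset.sum_nonneg fun x _ => by positivity)]
    exact volume_mul_sum_nodes_le h T (a k T)
  calc _ ≤ ∑ T : M.Elem, |∫ x in interior T.cell, ⟪g x, r T x⟫| :=
        Finset.abs_sum_le_sum_abs _ _
    _ ≤ _ := Finset.sum_le_sum fun T _ => key T
    _ = _ := by
        rw [← Finset.mul_sum, Finset.sum_add_distrib, ← Finset.mul_sum, ← Finset.mul_sum,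
          ← Finset.mul_sum, ← Finset.mul_sum]

variable {F : Type*} [NormedAddCommGroup F] [InnerProductSpace ℝ F] [FiniteDimensional ℝ F]

theorem two_mul_q1Form_le (a b : M.P1 F) {t : ℝ} (ht : 0 < t) :
    2 * q1Form M F a b ≤ t * q1Form M F a a + t⁻¹ * q1Form M F b b := by
  simp only [q1Form_apply, Finset.mul_sum, ← Finset.sum_add_distrib]
  refine Finset.sum_le_sum fun T _ => Finset.sum_le_sum fun x _ => ?_
  have h1 : 0 ≤ t⁻¹ * ‖t • a T x - b T x‖ ^ 2 := by positivity
  have h2 : t⁻¹ * ‖t • a T x - b T x‖ ^ 2 =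
      t * ⟪a T x, a T x⟫ - 2 * ⟪a T x, b T x⟫ + t⁻¹ * ⟪b T x, b T x⟫ := by
    rw [← real_inner_self_eq_norm_sq, real_inner_sub_sub_self, real_inner_smul_left,
      real_inner_smul_left, real_inner_smul_right]
    field_simp
  have h3 : 0 ≤ volume.real T.cell / (d + 1) := by positivity
  rw [h2] at h1
  have h4 := mul_nonneg h3 h1
  linarith

theorem norm_projRQ_sq_le (h : IsMoments d α β) (g : L2 M.domain F) {N : ℝ}
    (hN : ∀ r : M.P1 F, (∀ T, ∑ x ∈ T.nodes, r T x = 0) → ∀ t : ℝ, 0 < t →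
      |l2Form M F (proj1 g) r| ≤ (1 / 2) * (t * N + t⁻¹ * l2Form M F r r)) :
    ‖P1.toL2 M F (projRQ g)‖ ^ 2 ≤ 2 * ‖P1.toL2 M F (projR g)‖ ^ 2 +
      β * (d + 1) / α * (2 * (β * (d + 1) / α) + 1) * N := by
  set c := β * (d + 1) / α with hc
  have hc0 : 0 ≤ c := div_nonneg (mul_nonneg h.nonneg (by positivity)) h.pos.le
  set q := projRQ g
  have h1 := l2Form_self_le_q1Form h q
  rw [(projRQ_spec g).2 q (projRQ_spec g).1, q1Form_eq h, ← hc, l2Form_proj1,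
    ← (projR_spec g).2 q (projRQ_spec g).1, l2Form_self] at h1
  -- With `t = 2c + 1` one has `c / t ≤ 1/2`, so this term leaves only a quarter of `‖q‖²`. With the
  -- quarter from `h4`, half of `‖q‖²` is absorbed on the left.
  have h2 := hN q.meanFree q.sum_meanFree (2 * c + 1) (by positivity)
  have h3 := l2Form_meanFree_le h q
  rw [l2Form_self q] at h3
  have h4 : ⟪P1.toL2 M F (projR g), P1.toL2 M F q⟫ ≤
      ‖P1.toL2 M F (projR g)‖ ^ 2 + (1 / 4) * ‖P1.toL2 M F q‖ ^ 2 := by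
    have := real_inner_le_norm (P1.toL2 M F (projR g)) (P1.toL2 M F q)
    nlinarith [sq_nonneg (‖P1.toL2 M F (projR g)‖ - (1 / 2) * ‖P1.toL2 M F q‖)]
  have h5 : c * (2 * c + 1)⁻¹ ≤ 1 / 2 := by
    rw [← div_eq_mul_inv, div_le_iff₀ (by positivity)]
    linarith
  have h6 := mul_le_mul_of_nonneg_left ((le_abs_self _).trans h2) hc0
  have h7 : c * (2 * c + 1)⁻¹ * l2Form M F q.meanFree q.meanFree ≤
      1 / 2 * ‖P1.toL2 M F q‖ ^ 2 := by
    refine mul_le_mul h5 h3 ?_ (by norm_num)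
    rw [l2Form_self]
    positivity
  linarith

theorem norm_projR_sq_le (h : IsMoments d α β) (g : L2 M.domain F) {N : ℝ}
    (hN : ∀ r : M.P1 F, (∀ T, ∑ x ∈ T.nodes, r T x = 0) → ∀ t : ℝ, 0 < t →
      |l2Form M F (proj1 g) r| ≤ (1 / 2) * (t * N + t⁻¹ * l2Form M F r r)) :
    ‖P1.toL2 M F (projR g)‖ ^ 2 ≤ 2 * ((d + 1) * α)⁻¹ ^ 2 * ‖P1.toL2 M F (projRQ g)‖ ^ 2 +
      β * (d + 1) / α * (2 * (β * (d + 1) / α) + 1) * N := by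
  set c := β * (d + 1) / α with hc
  have hc0 : 0 ≤ c := div_nonneg (mul_nonneg h.nonneg (by positivity)) h.pos.le
  have hα := h.pos
  set κ := ((d : ℝ) + 1) * α with hκ
  have hκ0 : 0 < κ := by positivity
  set p := projR g
  set q := projRQ g
  -- The relation defining `projRQ` is read backwards, with `p` itself as the test function in
  -- `R_h`.
  have h1 : l2Form M F p p = q1Form M F q p - c * l2Form M F (proj1 g) p.meanFree := by
    have e1 : l2Form M F p p = l2Form M F (proj1 g) p := by
      rw [l2Form_proj1]
      exact (projR_spec g).2 p (projR_spec g).1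
    rw [e1, (projRQ_spec g).2 p (projR_spec g).1, q1Form_eq h, ← hc]
    ring
  have h2 := hN p.meanFree p.sum_meanFree (2 * c + 1) (by positivity)
  have h3 := l2Form_meanFree_le h p
  -- The weight is chosen so that, after passing from the quadrature to the `L²` norm at the cost of
  -- `κ⁻¹`, the `p` term is half of `‖p‖²`.
  have h4 := two_mul_q1Form_le q p (t := 2 * κ⁻¹) (by positivity)
  have hq : ∀ a : M.P1 F, q1Form M F a a ≤ κ⁻¹ * l2Form M F a a := by
    intro a
    rw [← div_eq_inv_mul, le_div_iff₀' hκ0]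
    exact q1Form_self_le_l2Form h a
  have h41 := mul_le_mul_of_nonneg_left (hq q) (show 0 ≤ 2 * κ⁻¹ by positivity)
  have h42 := mul_le_mul_of_nonneg_left (hq p) (show 0 ≤ (2 * κ⁻¹)⁻¹ by positivity)
  have e42 : (2 * κ⁻¹)⁻¹ * (κ⁻¹ * l2Form M F p p) = 1 / 2 * l2Form M F p p := by
    field_simp
  have h5 : c * (2 * c + 1)⁻¹ ≤ 1 / 2 := by
    rw [← div_eq_mul_inv, div_le_iff₀ (by positivity)]
    linarith
  have h6 := mul_le_mul_of_nonneg_left ((neg_le_abs _).trans h2) hc0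
  have h7 : c * (2 * c + 1)⁻¹ * l2Form M F p.meanFree p.meanFree ≤ 1 / 2 * l2Form M F p p := by
    refine mul_le_mul h5 h3 ?_ (by norm_num)
    rw [l2Form_self]
    positivity
  rw [← l2Form_self, ← l2Form_self]
  linarith

end SimplicialMesh

end Cosserat

/-! ### The constant and the equivalence of the norms. -/

theorem mainTheorem12 (d : ℕ) (hd : d = 2 ∨ d = 3) (γ L : ℝ) :
    ∃ C : ℝ, 0 < C ∧
      ∀ M : Cosserat.SimplicialMesh d, M.ShapeRegular γ →
      ∀ Γ : Set (Cosserat.Pt d), Γ ⊆ frontier M.domain →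
      ∀ ℓ : Cosserat.Pt d → ℝ, Cosserat.IsLengthScale M.domain L ℓ →
        (∀ T : M.Elem, Cosserat.MemSobolevInf (interior T.cell) 2 ℓ) →
      ∀ σ ∈ M.stressFE Γ, ∀ ω ∈ M.coupleStressFE Γ ℓ,
        M.normXQ ℓ σ ω ≤ C * M.normXh ℓ σ ω ∧ M.normXh ℓ σ ω ≤ C * M.normXQ ℓ σ ω := by
  obtain ⟨α, β, h⟩ := Cosserat.exists_isMoments (d := d) (by omega)
  have hα := h.pos
  have hβ := h.nonneg
  set c := β * (d + 1) / α * (2 * (β * (d + 1) / α) + 1) with hc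
  set K := (max L 0 * (1 + 4 * d * γ)) ^ 2 * α⁻¹ with hK
  have hc0 : 0 ≤ c := by positivity
  have hK0 : 0 ≤ K := by positivity
  set κ := 2 * (((d : ℝ) + 1) * α)⁻¹ ^ 2 with hκ
  have hκ0 : 0 ≤ κ := by positivity
  have hcK : 0 ≤ c * K := mul_nonneg hc0 hK0
  -- One constant serves both directions: the projected divergences cost factors `2` and `κ`, and
  -- each direction adds `c K` to the coefficient `1` of `‖ω‖²`.
  refine ⟨√(3 + κ + c * K), by positivity, ?_⟩
  intro M hM Γ _ ℓ hℓ _ σ _ ω hω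
  have hN : ∀ r : M.P1 (EuclideanSpace ℝ (Fin (d.choose 2))),
      (∀ T, ∑ x ∈ T.nodes, r T x = 0) → ∀ t : ℝ, 0 < t →
      |Cosserat.SimplicialMesh.l2Form M _ (Cosserat.SimplicialMesh.proj1
        (Cosserat.weakDiv M.domain (Cosserat.scaled ℓ ω))) r| ≤
        (1 / 2) * (t * (K * Cosserat.SimplicialMesh.normSq M.domain ω) +
          t⁻¹ * Cosserat.SimplicialMesh.l2Form M _ r r) := by
    intro r hr t ht
    rw [hK, mul_assoc]
    exact Cosserat.SimplicialMesh.abs_l2Form_proj1_weakDiv_le h hM hℓ hω r hr ht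
  have h1 := Cosserat.SimplicialMesh.norm_projRQ_sq_le h _ hN
  have h2 := Cosserat.SimplicialMesh.norm_projR_sq_le h _ hN
  rw [← hc, ← mul_assoc] at h1 h2
  have hnn : ∀ {m : ℕ} (τ : Cosserat.TensorField d m),
      0 ≤ Cosserat.SimplicialMesh.normSq M.domain τ := fun τ =>
    Finset.sum_nonneg fun k _ => MeasureTheory.integral_nonneg fun x => by positivity
  have hσ := hnn σ
  have hω' := hnn ω
  unfold Cosserat.SimplicialMesh.normXQ Cosserat.SimplicialMesh.normXh
  rw [← Real.sqrt_mul (by positivity), ← Real.sqrt_mul (by positivity)]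
  set A := Cosserat.SimplicialMesh.normSq M.domain σ
  set N := Cosserat.SimplicialMesh.normSq M.domain ω
  set D := ‖Cosserat.weakDiv M.domain σ‖ ^ 2 with hD
  have hD0 : 0 ≤ D := by positivity
  set P := ‖Cosserat.SimplicialMesh.P1.toL2 M _ (Cosserat.SimplicialMesh.projR
    (Cosserat.weakDiv M.domain (Cosserat.scaled ℓ ω)))‖ ^ 2 with hP
  have hP0 : 0 ≤ P := by positivity
  set Q := ‖Cosserat.SimplicialMesh.P1.toL2 M _ (Cosserat.SimplicialMesh.projRQ
    (Cosserat.weakDiv M.domain (Cosserat.scaled ℓ ω)))‖ ^ 2 with hQ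
  have hQ0 : 0 ≤ Q := by positivity
  constructor <;> refine Real.sqrt_le_sqrt ?_
  · nlinarith [mul_nonneg hcK hσ, mul_nonneg hcK hD0, mul_nonneg hcK hP0, mul_nonneg hκ0 hσ,
      mul_nonneg hκ0 hD0, mul_nonneg hκ0 hP0, mul_nonneg hκ0 hω']
  · nlinarith [mul_nonneg hcK hσ, mul_nonneg hcK hD0, mul_nonneg hcK hQ0, mul_nonneg hκ0 hσ,
      mul_nonneg hκ0 hD0, mul_nonneg hκ0 hQ0, mul_nonneg hκ0 hω']
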